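/- **Theorem 4.10.** Let $d\ge 1$, $m>0$, $\gamma\in[0,\frac{d+1}{2})$, and let $f(x)=e^{-m|x|}g(|x|)$ on $\mathbb R^d$ (with $|\cdot|$ the Euclidean norm and Lebesgue measure), where either $g(r)=r^{-\gamma}$ or $g(r)=(1\vee r)^{-\gamma}$ (values in $(0,\infty]$). Put $$f^{1\star}=f,\quad f^{n\star}(x)=\int_{\mathbb R^d} f(x-y)f^{(n-1)\star}(y)\,dy\ (n\ge2),\quad p_\lambda(x)=e^{-\lambda\|f\|_1}\sum_{n=1}^\infty\frac{\lambda^n f^{n\star}(x)}{n!},\quad \phi(\rho,\beta;t)=\sum_{n=0}^\infty\frac{t^n}{\Gamma(\rho n+\beta)\,n!}$$ (with $1/\Gamma(0)=0$). Then $f$ is integrable, and there are constants $C_1,C_2,C_3\ge 1$ such that $$f(x)\le C_1f(y)\ \text{ for } 1\le|x|\le|y|\le|x|+1,\qquad f(x)\le C_2f(2x)\ \text{ for } |x|\le1,\qquad g(r)\le C_3\,g(2r)\ \text{ for } r>0. \tag{$*$}$$ For arbitrary $C_1,C_2,C_3\ge1$ satisfying $(*)$ set $M_2=(C_1\vee C_2)\|f\|_1$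 and, for $d\ge2$, $$M_3=1\vee\frac{2\pi^{\frac{d-1}{2}}}{\Gamma(\frac{d-1}{2})}\int_0^\infty \exp\Big(-\frac{m}{\pi^2}\frac{s^2}{\sqrt{1+s^2}}\Big)s^{d-2}\,ds,\qquad M_4=1\wedge\frac{2^{d-1}}{C_3\,\pi^{\frac{d-3}{2}}\,\Gamma(\frac{d-1}{2})}.$$ Let $$r_0=\left(\frac{8\lceil b\rceil^{\lfloor b\rfloor}}{a_0^{1-\{b\}}}\right)^{1/a_0}\big(2^{1/a_0}e^{1/e}\big)^{2\lfloor b\rfloor},\qquad \{b\}=b-\lfloor b\rfloor,$$ with $a_0=b=d-\gamma$ if $g(r)=r^{-\gamma}$, and $a_0=1$, $b=d$ if $g(r)=(1\vee r)^{-\gamma}$; let $C=1$ if $d=1$ and $C=\frac{e^{-mr_0}}{d-1}$ if $d>1$. Set $D_1=C/2$, $D_2=1$ if $d=1$, and $D_1=CM_4/2$, $D_2=M_3$ if $d>1$. Let $\rho_1=d-\gamma$ if $g(r)=r^{-\gamma}$, $\rho_1=d$ if $g(r)=(1\vee r)^{-\gamma}$, $\rho_2=\frac{d+1}{2}-\gamma$,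 $\kappa_1=D_1\Gamma(\rho_1)$ and $\kappa_2=D_2\Gamma(\rho_2)$. Then the following hold. (1) For all $|x|\ge1$ and all integers $n\ge1$, $$D_1^{n-1}\frac{\Gamma(\rho_1)^n}{\Gamma(\rho_1n)}\le\frac{f^{n\star}(x)}{f(x)|x|^{(\frac{d+1}{2}-\gamma)(n-1)}}\le D_2^{n-1}\frac{\Gamma(\rho_2)^n}{\Gamma(\rho_2n)}+\frac{2M_2\,n\,(M_2+\kappa_2)^{n-1}}{D_2|x|^{\frac{d+1}{2}-\gamma}}.$$ In particular, for every integer $n\ge1$, $$D_1^{n-1}\frac{\Gamma(\rho_1)^n}{\Gamma(\rho_1n)}\le\liminf_{|x|\to\infty}\frac{f^{n\star}(x)}{f(x)|x|^{(\frac{d+1}{2}-\gamma)(n-1)}}\le\limsup_{|x|\to\infty}\frac{f^{n\star}(x)}{f(x)|x|^{(\frac{d+1}{2}-\gamma)(n-1)}}\le D_2^{n-1}\frac{\Gamma(\rho_2)^n}{\Gamma(\rho_2n)}.$$ (2) For all $|x|\ge1$ and all $\lambda>0$, $$\phi\big(\rho_1,0;\kappa_1\lambda|x|^{\frac{d+1}{2}-\gamma}\big)\le\frac{p_\lambda(x)}{e^{-\lambda\|f\|_1}e^{-m|x|}|x|^{-\frac{d+1}{2}}}\le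 e^{M_2\lambda}\,\phi\big(\rho_2,0;\kappa_2\lambda|x|^{\frac{d+1}{2}-\gamma}\big).$$ -/

import Mathlib

open MeasureTheory Filter
open scoped ENNReal

noncomputable section

namespace ExpDens

/-- The space `ℝ^d` with its Euclidean norm and Lebesgue measure. -/
abbrev E (d : ℕ) : Type := EuclideanSpace ℝ (Fin d)

/-- The two kinds of smaller order term: `r ^ (-γ)` and `(1 ∨ r) ^ (-γ)`. -/
inductive Kind : Type
  | power
  | truncated

/-- The profile `g : ℝ → (0, ∞]`; for `power` and `γ > 0` it is `∞` at `r = 0`. -/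
def profile (γ : ℝ) : Kind → ℝ → ℝ≥0∞
  | Kind.power, r => ENNReal.ofReal r ^ (-γ)
  | Kind.truncated, r => ENNReal.ofReal (max 1 r) ^ (-γ)

/-- The function `f(x) = e^{-m|x|} g(|x|)` on `ℝ^d`, with values in `(0, ∞]`. -/
def expDensity (d : ℕ) (m : ℝ) (g : ℝ → ℝ≥0∞) (x : E d) : ℝ≥0∞ :=
  ENNReal.ofReal (Real.exp (-m * ‖x‖)) * g ‖x‖

/-- The `L¹` norm of a nonnegative function, as a real number (for integrable functions). -/
def l1norm {d : ℕ} (f : E d → ℝ≥0∞) : ℝ := (∫⁻ x, f x).toReal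

/-- The `n`-fold convolution `f^{n⋆}`, `n ≥ 1` (the value at `n = 0` is a placeholder and is
never used). -/
def convPow {d : ℕ} (f : E d → ℝ≥0∞) : ℕ → E d → ℝ≥0∞
  | 0 => fun _ => 0
  | 1 => f
  | n + 2 => fun x => ∫⁻ y, f (x - y) * convPow f (n + 1) y

/-- The density `p_λ = e^{-λ‖f‖₁} ∑_{n ≥ 1} λ^n f^{n⋆} / n!` of the absolutely continuous part of
the compound Poisson measure with parameter `lam` built for `f`. -/
def compoundPoissonDensity {d : ℕ} (f : E d → ℝ≥0∞) (lam : ℝ) (x : E d) : ℝ≥0∞ :=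
  ENNReal.ofReal (Real.exp (-lam * l1norm f)) *
    ∑' n : ℕ, ENNReal.ofReal (lam ^ (n + 1) / ((n + 1).factorial : ℝ)) * convPow f (n + 1) x

/-- The generalized Bessel (Wright) function `φ(ρ, β; t) = ∑_{n ≥ 0} t^n / (Γ(ρ n + β) n!)`.
For `β = 0` the term `n = 0` vanishes, by the usual convention `1 / Γ(0) = 0`, which also holds
for `Real.Gamma`. -/
def wright (ρ β t : ℝ) : ℝ :=
  ∑' n : ℕ, t ^ n / (Real.Gamma (ρ * n + β) * (n.factorial : ℝ))

/-- `C₁ ≥ 1` and `f(x) ≤ C₁ f(y)` for `1 ≤ |x| ≤ |y| ≤ |x| + 1`. -/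
def IsStepConst {d : ℕ} (f : E d → ℝ≥0∞) (C₁ : ℝ) : Prop :=
  1 ≤ C₁ ∧ ∀ x y : E d, 1 ≤ ‖x‖ → ‖x‖ ≤ ‖y‖ → ‖y‖ ≤ ‖x‖ + 1 → f x ≤ ENNReal.ofReal C₁ * f y

/-- `C₂ ≥ 1` and `f(x) ≤ C₂ f(2x)` for `|x| ≤ 1`. -/
def IsDoublingAtZeroConst {d : ℕ} (f : E d → ℝ≥0∞) (C₂ : ℝ) : Prop :=
  1 ≤ C₂ ∧ ∀ x : E d, ‖x‖ ≤ 1 → f x ≤ ENNReal.ofReal C₂ * f ((2 : ℝ) • x)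

/-- `C₃ ≥ 1` and `g(r) ≤ C₃ g(2r)` for `r > 0`. -/
def IsDoublingConst (g : ℝ → ℝ≥0∞) (C₃ : ℝ) : Prop :=
  1 ≤ C₃ ∧ ∀ r : ℝ, 0 < r → g r ≤ ENNReal.ofReal C₃ * g (2 * r)

/-- `M₂ = (C₁ ∨ C₂) ‖f‖₁`. -/
def M₂ {d : ℕ} (f : E d → ℝ≥0∞) (C₁ C₂ : ℝ) : ℝ := max C₁ C₂ * l1norm f

/-- `M₃ = 1 ∨ (2 π^{(d-1)/2} / Γ((d-1)/2) ∫_0^∞ exp(-(m/π²) s²/√(1+s²)) s^{d-2} ds)`; used for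
`d ≥ 2`. -/
def M₃ (d : ℕ) (m : ℝ) : ℝ :=
  max 1 (2 * Real.pi ^ (((d : ℝ) - 1) / 2) / Real.Gamma (((d : ℝ) - 1) / 2) *
    ∫ s in Set.Ioi (0 : ℝ),
      Real.exp (-(m / Real.pi ^ 2) * (s ^ 2 / Real.sqrt (1 + s ^ 2))) * s ^ ((d : ℝ) - 2))

/-- `M₄ = 1 ∧ 2^{d-1} / (C₃ π^{(d-3)/2} Γ((d-1)/2))`; used for `d ≥ 2`. -/
def M₄ (d : ℕ) (C₃ : ℝ) : ℝ :=
  min 1 ((2 : ℝ) ^ ((d : ℝ) - 1) /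
    (C₃ * Real.pi ^ (((d : ℝ) - 3) / 2) * Real.Gamma (((d : ℝ) - 1) / 2)))

/-- The threshold
`(8 ⌈b⌉^⌊b⌋ / a₀^{1-{b}})^{1/a₀} (2^{1/a₀} e^{1/e})^{2⌊b⌋}`, where `{b} = b - ⌊b⌋`. -/
def threshold (a₀ b : ℝ) : ℝ :=
  (8 * (⌈b⌉₊ : ℝ) ^ ⌊b⌋₊ / a₀ ^ (1 - Int.fract b)) ^ (1 / a₀) *
    ((2 : ℝ) ^ (1 / a₀) * Real.exp (1 / Real.exp 1)) ^ (2 * ⌊b⌋₊)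

/-- The number `r₀`: the threshold with `a₀ = b = d - γ` for `g(r) = r^{-γ}`, and with
`a₀ = 1`, `b = d` for `g(r) = (1 ∨ r)^{-γ}`. -/
def r₀ (d : ℕ) (γ : ℝ) : Kind → ℝ
  | Kind.power => threshold (d - γ) (d - γ)
  | Kind.truncated => threshold 1 d

/-- `C = 1` if `d = 1`, and `C = e^{-m r₀} / (d - 1)` if `d > 1`. -/
def constC (d : ℕ) (m γ : ℝ) (k : Kind) : ℝ :=
  if d = 1 then 1 else Real.exp (-m * r₀ d γ k) / ((d : ℝ) - 1)

/-- `D₁ = C / 2` if `d = 1`, and `D₁ = C M₄ / 2` if `d > 1`. -/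
def D₁ (d : ℕ) (m γ C₃ : ℝ) (k : Kind) : ℝ :=
  if d = 1 then constC d m γ k / 2 else constC d m γ k * M₄ d C₃ / 2

/-- `D₂ = 1` if `d = 1`, and `D₂ = M₃` if `d > 1`. -/
def D₂ (d : ℕ) (m : ℝ) : ℝ := if d = 1 then 1 else M₃ d m

/-- `ρ₁ = d - γ` for `g(r) = r^{-γ}`, and `ρ₁ = d` for `g(r) = (1 ∨ r)^{-γ}`. -/
def ρ₁ (d : ℕ) (γ : ℝ) : Kind → ℝ
  | Kind.power => d - γ
  | Kind.truncated => d

/-- `ρ₂ = (d + 1) / 2 - γ`. -/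
def ρ₂ (d : ℕ) (γ : ℝ) : ℝ := ((d : ℝ) + 1) / 2 - γ

/-- `κ₁ = D₁ Γ(ρ₁)`. -/
def κ₁ (d : ℕ) (m γ C₃ : ℝ) (k : Kind) : ℝ := D₁ d m γ C₃ k * Real.Gamma (ρ₁ d γ k)

/-- `κ₂ = D₂ Γ(ρ₂)`. -/
def κ₂ (d : ℕ) (m γ : ℝ) : ℝ := D₂ d m * Real.Gamma (ρ₂ d γ)

/-- The ratio `f^{n⋆}(x) / (f(x) |x|^{((d+1)/2 - γ)(n-1)})`. -/
def convRatio {d : ℕ} (f : E d → ℝ≥0∞) (γ : ℝ) (n : ℕ) (x : E d) : ℝ≥0∞ :=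
  convPow f n x / (f x * ENNReal.ofReal (‖x‖ ^ ((((d : ℝ) + 1) / 2 - γ) * ((n : ℝ) - 1))))

/-- The ratio `p_λ(x) / (e^{-λ‖f‖₁} e^{-m|x|} |x|^{-(d+1)/2})`. -/
def poissonRatio {d : ℕ} (f : E d → ℝ≥0∞) (m lam : ℝ) (x : E d) : ℝ≥0∞ :=
  compoundPoissonDensity f lam x /
    ENNReal.ofReal
      (Real.exp (-lam * l1norm f) * Real.exp (-m * ‖x‖) * ‖x‖ ^ (-(((d : ℝ) + 1) / 2)))

end ExpDens

end

open ExpDens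

/-!
The densities are `f(x) = e^{-m|x|} g(|x|)`, and the key fact is that `e^{-m|y|} e^{-m|x-y|}` is
close to `e^{-m|x|}` exactly when `y` is near the segment from `0` to `x`. Integrating out the
directions orthogonal to this segment turns `f ⋆ f^{n⋆}` into a one-dimensional convolution on
`(0, |x|)` of powers, which is a beta integral. Iterating these gives the quotients
`Γ(ρ)^n / Γ(ρ n)`.

For the lower bound (`le_convPow`) the section of the region of integration at distance `s` from
`0` is a ball of radius `√(u · min(u, 1))`, where `u = s (|x| - s) / |x|`. There the exponent loses
at most `m/2` and the profiles lose bounded factors (`le_lintegral_slice`). The resulting bound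
carries the weight `lowerWeight`, equal to `r ^ ρ₁` for `r ≤ 1` and to `r ^ ρ₂` for `r ≥ 1`, and
reproduces itself up to the factor `B(ρ₁, ρ₁ n)` (`beta_density_le`). The constant `D₁` is smaller
than what this argument provides (`D₁_le`).

For the upper bound (`convPow_le`) let `M = M₂`, `κ = κ₂`, `q = ρ₂`. By induction on `n`, for
`|x| = r ≥ 1`,
`D₂ f^{n⋆}(x) ≤ e^{-mr} r^{-(d+1)/2} ∑_{k=1}^n C(n,k) M^{n-k} κ^k r^{qk} / Γ(qk)`.
In the step, the part of the integral where `f(x - y)` is comparable to `f(x)` contributes a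
power of `M`, and the part where `f^{n⋆}(y)` is comparable to its bound at `x` contributes `M` times
the bound for `n`. The latter uses that `f^{n⋆}` is radially nonincreasing
(`RadiallyAntitone.conv`), because the bound itself is not. On the remaining `y`, where
`1 ≤ |y| ≤ r - 1`, spherical coordinates and `add_angularDecay_le` give the factor `D₂ B(q, qk)`
(`lintegral_mainRegion_mul_le`). Pascal's rule puts the three parts together (`upperPoly_succ`).

The top term `k = n` yields the leading constant, and `C(n,k) ≤ n C(n-1,k)` for `k < n` together
with `Γ ≥ 1/2` bounds the other ones. Multiplied by `λ^n / n!` and summed over `n`, the bound is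
the Cauchy product of `e^{Mλ}` and a Wright function.
-/

namespace ExpDens

/-! ### Cylindrical and polar coordinates -/

/-- Cylindrical coordinates with axis `e`: `s` is the coordinate along `e`, and `z` is the component
orthogonal to `e`. Only the distances to `0` and to a point `r • e` of the axis matter here. -/
theorem exists_cylindrical {D : ℕ} (e : E (D + 1)) (he : ‖e‖ = 1) :
    ∃ ψ : ℝ × E D ≃ᵐ E (D + 1), MeasurePreserving ψ ∧
      ∀ s z r, ‖ψ (s, z)‖ = √(s ^ 2 + ‖z‖ ^ 2) ∧
        ‖r • e - ψ (s, z)‖ = √((r - s) ^ 2 + ‖z‖ ^ 2) := by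
  have key : ∀ (F : Type) [NormedAddCommGroup F] [InnerProductSpace ℝ F] [FiniteDimensional ℝ F]
      (v : F), ‖v‖ = 1 → Module.finrank ℝ F = D + 1 →
      ∃ b : OrthonormalBasis (Fin (D + 1)) ℝ F, b 0 = v := by
    intro F _ _ _ v hv hF
    obtain ⟨b, hb⟩ := Orthonormal.exists_orthonormalBasis_extension_of_card_eq (𝕜 := ℝ) (E := F)
      (ι := Fin (D + 1)) (by simpa using hF) (v := fun _ => v) (s := {0}) (by
        constructor
        · intro i; simpa using hv
        · intro i j hij
          exact absurd (Subsingleton.elim i j) hij)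
    exact ⟨b, hb 0 rfl⟩
  obtain ⟨b, hb⟩ := key (E (D + 1)) e he (by simp)
  obtain ⟨b', hb'⟩ := key (WithLp 2 (ℝ × E D)) (WithLp.toLp 2 (1, 0)) (by simp) (by
      rw [LinearEquiv.finrank_eq (WithLp.linearEquiv 2 ℝ (ℝ × E D))]
      simp [add_comm])
  let φ : WithLp 2 (ℝ × E D) ≃ₗᵢ[ℝ] E (D + 1) := b'.equiv b (Equiv.refl _)
  have hφ : φ (WithLp.toLp 2 (1, 0)) = e := by
    rw [← hb', ← hb]
    simp [φ]
  have hφm : MeasurePreserving φ := φ.measurePreserving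
  refine ⟨(MeasurableEquiv.toLp 2 (ℝ × E D)).trans φ.toHomeomorph.toMeasurableEquiv, ?_, ?_⟩
  · exact hφm.comp (WithLp.volume_preserving_toLp ℝ (E D))
  · intro s z r
    constructor
    · change ‖φ (WithLp.toLp 2 (s, z))‖ = _
      rw [φ.norm_map, WithLp.prod_norm_eq_of_L2]
      simp
    · change ‖r • e - φ (WithLp.toLp 2 (s, z))‖ = _
      rw [← hφ, ← map_smul, ← map_sub, φ.norm_map, WithLp.prod_norm_eq_of_L2]
      simp

theorem lintegral_cylindrical {D : ℕ} (e : E (D + 1)) (he : ‖e‖ = 1) (r : ℝ)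
    (G : ℝ → ℝ → ℝ≥0∞) (hG : Measurable (Function.uncurry G)) :
    ∫⁻ y : E (D + 1), G ‖r • e - y‖ ‖y‖ =
      ∫⁻ s : ℝ, ∫⁻ z : E D, G (√((r - s) ^ 2 + ‖z‖ ^ 2)) (√(s ^ 2 + ‖z‖ ^ 2)) := by
  obtain ⟨ψ, hψ, hn⟩ := exists_cylindrical e he
  rw [← hψ.lintegral_comp_emb ψ.measurableEmbedding, Measure.volume_eq_prod, lintegral_prod]
  · refine lintegral_congr fun s => lintegral_congr fun z => ?_
    rw [(hn s z r).1, (hn s z r).2]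
  · refine Measurable.aemeasurable ?_
    have h1 : Measurable fun p : ℝ × E D => (‖r • e - ψ p‖, ‖ψ p‖) := by fun_prop
    exact hG.comp h1

/-- Integration in polar coordinates of a radial function with values in `[0, ∞]`. -/
theorem lintegral_fun_norm {D : ℕ} (hD : 1 ≤ D) (f : ℝ → ℝ≥0∞) (hf : Measurable f) :
    ∫⁻ x : E D, f ‖x‖ =
      D * volume (Metric.ball (0 : E D) 1) *
        ∫⁻ t in Set.Ioi (0 : ℝ), ENNReal.ofReal (t ^ (D - 1)) * f t := by
  have : Nonempty (Fin D) := ⟨⟨0, hD⟩⟩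
  have hdim : Module.finrank ℝ (E D) = D := by simp
  calc
    ∫⁻ x : E D, f ‖x‖ = ∫⁻ x : ({(0 : E D)}ᶜ : Set (E D)), f ‖(x : E D)‖
        ∂(volume.comap Subtype.val) := by
      rw [lintegral_subtype_comap (measurableSet_singleton _).compl fun x ↦ f ‖x‖,
        restrict_compl_singleton]
    _ = ∫⁻ x, f x.2 ∂(volume : Measure (E D)).toSphere.prod
          (.volumeIoiPow (Module.finrank ℝ (E D) - 1)) := by
      simpa using
        (volume : Measure (E D)).measurePreserving_homeomorphUnitSphereProd.lintegral_comp_emb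
          (Homeomorph.measurableEmbedding _) (fun p => f p.2)
    _ = (volume : Measure (E D)).toSphere Set.univ *
          ∫⁻ x : Set.Ioi (0 : ℝ), f x ∂(.volumeIoiPow (Module.finrank ℝ (E D) - 1)) := by
      rw [lintegral_prod_symm]
      · simp only [lintegral_const]
        rw [lintegral_mul_const, mul_comm]
        exact hf.comp measurable_subtype_coe
      · exact ((hf.comp measurable_subtype_coe).comp measurable_snd).aemeasurable
    _ = _ := by
      rw [Measure.toSphere_apply_univ, hdim, Measure.volumeIoiPow,
        lintegral_withDensity_eq_lintegral_mul _ (by fun_prop)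
          (g := fun x : Set.Ioi (0 : ℝ) => f x) (hf.comp measurable_subtype_coe)]
      congr 1
      exact lintegral_subtype_comap measurableSet_Ioi
        (fun t : ℝ => ENNReal.ofReal (t ^ (D - 1)) * f t)

/-! ### The beta integral and a lower bound for the Gamma function -/

theorem lintegral_comp_mul_left (f : ℝ → ℝ≥0∞) {a : ℝ} (ha : 0 < a) :
    ∫⁻ t, f (a * t) = ENNReal.ofReal a⁻¹ * ∫⁻ t, f t := by
  have h := (Homeomorph.mulLeft₀ a ha.ne').measurableEmbedding.lintegral_map (μ := volume) f
  change ∫⁻ t, f t ∂(Measure.map (a * ·) volume) = ∫⁻ t, f (a * t) at h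
  rw [← h, Real.map_volume_mul_left ha.ne', lintegral_smul_measure, abs_of_pos (inv_pos.mpr ha),
    smul_eq_mul]

theorem lintegral_beta {α β r : ℝ} (hα : 0 < α) (hβ : 0 < β) (hr : 0 < r) :
    ∫⁻ s in Set.Ioo 0 r, ENNReal.ofReal ((r - s) ^ (α - 1) * s ^ (β - 1)) =
      ENNReal.ofReal (r ^ (α + β - 1) *
        (Real.Gamma α * Real.Gamma β / Real.Gamma (α + β))) := by
  have hB := ProbabilityTheory.beta_pos hβ hα
  have h1 : ∫⁻ t in Set.Ioo (0 : ℝ) 1, ENNReal.ofReal (t ^ (β - 1) * (1 - t) ^ (α - 1)) =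
      ENNReal.ofReal (ProbabilityTheory.beta β α) := by
    have h := ProbabilityTheory.lintegral_betaPDF_eq_one hβ hα
    rw [ProbabilityTheory.lintegral_betaPDF] at h
    have h2 : ∀ t : ℝ, ENNReal.ofReal
        (1 / ProbabilityTheory.beta β α * t ^ (β - 1) * (1 - t) ^ (α - 1)) =
        ENNReal.ofReal (ProbabilityTheory.beta β α)⁻¹ *
          ENNReal.ofReal (t ^ (β - 1) * (1 - t) ^ (α - 1)) := by
      intro t
      rw [← ENNReal.ofReal_mul (by positivity), one_div, mul_assoc]
    simp_rw [h2] at h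
    rw [lintegral_const_mul _ (by fun_prop)] at h
    rw [ENNReal.ofReal_inv_of_pos hB] at h
    rw [mul_comm] at h
    have := ENNReal.eq_inv_of_mul_eq_one_left h
    rw [this, inv_inv]
  have h3 : ∫⁻ s in Set.Ioo 0 r, ENNReal.ofReal ((r - s) ^ (α - 1) * s ^ (β - 1)) =
      ENNReal.ofReal r * ∫⁻ t in Set.Ioo (0 : ℝ) 1,
        ENNReal.ofReal ((r - r * t) ^ (α - 1) * (r * t) ^ (β - 1)) := by
    rw [← lintegral_indicator measurableSet_Ioo, ← lintegral_indicator measurableSet_Ioo]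
    have h := lintegral_comp_mul_left
      ((Set.Ioo 0 r).indicator fun s => ENNReal.ofReal ((r - s) ^ (α - 1) * s ^ (β - 1))) hr
    have h' : ∀ t, (Set.Ioo 0 r).indicator
        (fun s => ENNReal.ofReal ((r - s) ^ (α - 1) * s ^ (β - 1))) (r * t) =
        (Set.Ioo 0 1).indicator
          (fun t => ENNReal.ofReal ((r - r * t) ^ (α - 1) * (r * t) ^ (β - 1))) t := by
      intro t
      have : r * t ∈ Set.Ioo 0 r ↔ t ∈ Set.Ioo (0 : ℝ) 1 := by
        simp [Set.mem_Ioo, hr]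
      by_cases ht : t ∈ Set.Ioo (0 : ℝ) 1
      · rw [Set.indicator_of_mem ht, Set.indicator_of_mem (this.mpr ht)]
      · rw [Set.indicator_of_notMem ht, Set.indicator_of_notMem (mt this.mp ht)]
    simp_rw [h'] at h
    rw [h, ← mul_assoc, ← ENNReal.ofReal_mul hr.le, mul_inv_cancel₀ hr.ne', ENNReal.ofReal_one,
      one_mul]
  rw [h3, ← lintegral_const_mul _ (by fun_prop)]
  have h4 : ∀ t ∈ Set.Ioo (0 : ℝ) 1, ENNReal.ofReal r *
      ENNReal.ofReal ((r - r * t) ^ (α - 1) * (r * t) ^ (β - 1)) =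
      ENNReal.ofReal (r ^ (α + β - 1)) *
        ENNReal.ofReal (t ^ (β - 1) * (1 - t) ^ (α - 1)) := by
    intro t ht
    rw [← ENNReal.ofReal_mul hr.le, ← ENNReal.ofReal_mul (by positivity)]
    congr 1
    have : r - r * t = r * (1 - t) := by ring
    rw [this, Real.mul_rpow hr.le (by linarith [ht.2]), Real.mul_rpow hr.le ht.1.le]
    have : r ^ (α + β - 1) = r * r ^ (α - 1) * r ^ (β - 1) := by
      nth_rw 2 [← Real.rpow_one r]
      rw [← Real.rpow_add hr, ← Real.rpow_add hr]
      ring_nf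
    rw [this]; ring
  rw [setLIntegral_congr_fun measurableSet_Ioo h4, lintegral_const_mul _ (by fun_prop), h1,
    ← ENNReal.ofReal_mul (by positivity)]
  rw [ProbabilityTheory.beta, add_comm β α, mul_comm (Real.Gamma β)]

/-- Logarithmic convexity gives `Γ(y) Γ(3 - y) ≥ Γ(3/2)² = π/4` for `1 ≤ y ≤ 2`, where
`Γ(3 - y) ≤ 1`; the functional equation and monotonicity on `[2, ∞)` do the rest. -/
theorem half_le_Gamma {x : ℝ} (hx : 0 < x) : 1 / 2 ≤ Real.Gamma x := by
  have h12 : ∀ y : ℝ, 1 ≤ y → y ≤ 2 → 1 / 2 ≤ Real.Gamma y := by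
    intro y h1 h2
    have hle : Real.Gamma (3 - y) ≤ 1 := by
      have := Real.convexOn_Gamma.2 (show (1 : ℝ) ∈ Set.Ioi 0 by simp)
        (show (2 : ℝ) ∈ Set.Ioi 0 by simp) (show 0 ≤ y - 1 by linarith)
        (show 0 ≤ 2 - y by linarith) (by ring)
      simp only [smul_eq_mul, Real.Gamma_one, Real.Gamma_two] at this
      have h3 : (y - 1) * 1 + (2 - y) * 2 = 3 - y := by ring
      rw [h3] at this
      linarith
    have hlog := Real.Gamma_mul_add_mul_le_rpow_Gamma_mul_rpow_Gamma (s := y) (t := 3 - y)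
      (a := 1 / 2) (b := 1 / 2) (by linarith) (by linarith) (by norm_num) (by norm_num)
      (by norm_num)
    have h3 : 1 / 2 * y + 1 / 2 * (3 - y) = (1 / 2 : ℝ) + 1 := by ring
    rw [h3, Real.Gamma_add_one (by norm_num), Real.Gamma_one_half_eq] at hlog
    have hG1 : 0 < Real.Gamma y := Real.Gamma_pos_of_pos (by linarith)
    have hG2 : 0 < Real.Gamma (3 - y) := Real.Gamma_pos_of_pos (by linarith)
    rw [← Real.sqrt_eq_rpow, ← Real.sqrt_eq_rpow, ← Real.sqrt_mul hG1.le] at hlog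
    have h4 : (1 / 2 * √Real.pi) ^ 2 ≤ Real.Gamma y * Real.Gamma (3 - y) := by
      rw [← Real.le_sqrt (by positivity) (by positivity)]
      exact hlog
    rw [mul_pow, Real.sq_sqrt Real.pi_pos.le] at h4
    nlinarith [Real.pi_gt_three]
  rcases lt_or_ge x 1 with h | h
  · have h1 := h12 (x + 1) (by linarith) (by linarith)
    rw [Real.Gamma_add_one hx.ne'] at h1
    have := Real.Gamma_pos_of_pos hx
    nlinarith
  · rcases le_or_gt x 2 with h' | h'
    · exact h12 x h h'
    · have := Real.Gamma_strictMonoOn_Ici.monotoneOn (a := 2) (b := x) (by simp) h'.le h'.le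
      rw [Real.Gamma_two] at this
      linarith

/-! ### Radially nonincreasing functions -/

variable {d : ℕ}

/-- A function on `ℝ^d` that does not increase with the norm. Comparing points of equal norm
shows that such a function is radial. -/
def RadiallyAntitone (f : E d → ℝ≥0∞) : Prop := ∀ x y : E d, ‖x‖ ≤ ‖y‖ → f y ≤ f x

/-- The rearrangement inequality for two pairs. -/
theorem mul_add_mul_le_of_le {a b c d : ℝ≥0∞} (hab : b ≤ a) (hcd : d ≤ c) :
    a * d + b * c ≤ a * c + b * d := by
  obtain ⟨u, rfl⟩ := exists_add_of_le hab
  obtain ⟨v, rfl⟩ := exists_add_of_le hcd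
  have : (b + u) * d + b * (d + v) + u * v = (b + u) * (d + v) + b * d := by ring
  rw [← this]
  exact le_self_add

/-- The convolution of two radially nonincreasing functions is radially nonincreasing. For
`‖x‖ ≤ ‖x'‖` let `σ` be the reflection in the bisecting hyperplane of `x` and `x'`. On the side of
`x`, which contains `0`, both `‖y‖ ≤ ‖σ y‖` and `‖x - y‖ ≤ ‖x' - y‖` hold, while `σ` exchanges the
distances to `x` and to `x'`, so that the rearrangement inequality applies on `{y, σ y}`. -/
theorem RadiallyAntitone.conv {f h : E d → ℝ≥0∞} (hf : RadiallyAntitone f)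
    (hh : RadiallyAntitone h) (hfm : Measurable f) (hhm : Measurable h) :
    RadiallyAntitone fun x => ∫⁻ y, f (x - y) * h y := by
  intro x x' hxx
  rcases eq_or_ne x x' with rfl | hne
  · exact le_rfl
  set n : E d := x' - x with hn
  have hn0 : n ≠ 0 := sub_ne_zero.mpr hne.symm
  set mid : E d := (1 / 2 : ℝ) • (x + x') with hmid
  let L : E d ≃ₗᵢ[ℝ] E d := (ℝ ∙ n)ᗮ.reflection
  have hLn : L n = -n := Submodule.reflection_orthogonalComplement_singleton_eq_neg n
  have hLL : ∀ v, L (L v) = v := Submodule.reflection_reflection _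
  have hL : ∀ v, L v = v - (2 * (inner ℝ n v / ‖n‖ ^ 2)) • n := by
    intro v
    have h := Submodule.reflection_singleton_apply (𝕜 := ℝ) n v
    have h' : L v = -((ℝ ∙ n).reflection v) := Submodule.reflection_orthogonal_apply _ v
    rw [h', h, neg_sub, ← Nat.cast_smul_eq_nsmul ℝ, smul_smul]
    simp
  let σ : E d → E d := fun y => L (y - mid) + mid
  have hσm : MeasurePreserving σ :=
    (measurePreserving_add_right volume mid).comp
      (L.measurePreserving.comp (measurePreserving_sub_right volume mid))
  have hσσ : ∀ y, σ (σ y) = y := by intro y; simp [σ, hLL]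
  have hxm : x - mid = -((1 / 2 : ℝ) • n) := by rw [hmid, hn]; module
  have hxm' : x' - mid = (1 / 2 : ℝ) • n := by rw [hmid, hn]; module
  have hd : ∀ y, ‖x - σ y‖ = ‖x' - y‖ := by
    intro y
    have : x - σ y = L (x' - y) := by
      have h1 : x' - y = (1 / 2 : ℝ) • n - (y - mid) := by rw [← hxm']; abel
      rw [h1, map_sub, map_smul, hLn, smul_neg, ← hxm]
      simp only [σ]; abel
    rw [this, L.norm_map]
  have hd' : ∀ y, ‖x' - σ y‖ = ‖x - y‖ := by
    intro y
    rw [← hσσ y, hd, hσσ]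
  have hnm : 0 ≤ inner ℝ n mid := by
    have : inner ℝ n mid = 1 / 2 * (‖x'‖ ^ 2 - ‖x‖ ^ 2) := by
      rw [hn, hmid, real_inner_smul_right, inner_sub_left, inner_add_right, inner_add_right,
        real_inner_self_eq_norm_sq, real_inner_self_eq_norm_sq, real_inner_comm x x']
      ring
    rw [this]
    have := pow_le_pow_left₀ (norm_nonneg x) hxx 2
    linarith
  have hn2 : 0 < ‖n‖ ^ 2 := by positivity
  have hσn : ∀ y, inner ℝ n (y - mid) ≤ 0 → ‖y‖ ≤ ‖σ y‖ := by
    intro y hy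
    obtain ⟨t, ht⟩ : ∃ t, t = inner ℝ n (y - mid) / ‖n‖ ^ 2 := ⟨_, rfl⟩
    have ht0 : t ≤ 0 := ht ▸ div_nonpos_of_nonpos_of_nonneg hy hn2.le
    have e : σ y = y - (2 * t) • n := by simp only [σ, hL, ← ht]; abel
    have hty : inner ℝ n y = t * ‖n‖ ^ 2 + inner ℝ n mid := by
      rw [ht, div_mul_cancel₀ _ hn2.ne', inner_sub_right]; ring
    apply le_of_sq_le_sq _ (norm_nonneg _)
    rw [e, norm_sub_sq_real, real_inner_smul_right, real_inner_comm, hty, norm_smul, mul_pow,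
      Real.norm_eq_abs, sq_abs]
    nlinarith [mul_nonneg (neg_nonneg.mpr ht0) hnm]
  have hxy : ∀ y, inner ℝ n (y - mid) ≤ 0 → ‖x - y‖ ≤ ‖x' - y‖ := by
    intro y hy
    apply le_of_sq_le_sq _ (norm_nonneg _)
    have e1 : x - y = -((1 / 2 : ℝ) • n) - (y - mid) := by rw [← hxm]; abel
    have e2 : x' - y = (1 / 2 : ℝ) • n - (y - mid) := by rw [← hxm']; abel
    rw [e1, e2]
    generalize y - mid = w at hy
    rw [norm_sub_sq_real, norm_sub_sq_real, norm_neg, inner_neg_left,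
      real_inner_smul_left]
    linarith
  have hm1 : ∀ w : E d, Measurable fun y => f (w - y) * h y := fun w =>
    (hfm.comp (by fun_prop)).mul hhm
  -- Averaging over the reflection compares the two integrands on each orbit `{y, σ y}`.
  have hinv : ∀ w : E d, ∫⁻ y, f (w - y) * h y + f (w - σ y) * h (σ y) =
      2 * ∫⁻ y, f (w - y) * h y := by
    intro w
    rw [lintegral_add_left (hm1 w), hσm.lintegral_comp (hm1 w), two_mul]
  change ∫⁻ y, f (x' - y) * h y ≤ ∫⁻ y, f (x - y) * h y
  rw [← ENNReal.mul_le_mul_iff_right two_ne_zero ENNReal.ofNat_ne_top, ← hinv, ← hinv]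
  refine lintegral_mono fun y => ?_
  have e1 : f (x - σ y) = f (x' - y) := le_antisymm (hf _ _ (hd y).ge) (hf _ _ (hd y).le)
  have e2 : f (x' - σ y) = f (x - y) := le_antisymm (hf _ _ (hd' y).ge) (hf _ _ (hd' y).le)
  simp only [e1, e2]
  rcases le_total (inner ℝ n (y - mid)) 0 with hy | hy
  · rw [add_comm]
    exact mul_add_mul_le_of_le (hf _ _ (hxy y hy)) (hh _ _ (hσn y hy))
  · have hy' : inner ℝ n (σ y - mid) ≤ 0 := by
      have : σ y - mid = L (y - mid) := by simp [σ]
      rw [this, ← L.inner_map_map, hLL, hLn, inner_neg_left]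
      linarith
    have h1 := hf _ _ (hxy _ hy')
    have h2 := hh _ _ (hσn _ hy')
    rw [hσσ] at h2
    rw [e1, e2] at h1
    rw [add_comm (f (x - y) * h y)]
    exact mul_add_mul_le_of_le h1 h2

/-! ### The density and its convolution powers -/

/-- The real-valued version of `profile`; the two agree at positive arguments. -/
noncomputable def profileReal (γ : ℝ) : Kind → ℝ → ℝ
  | Kind.power, r => r ^ (-γ)
  | Kind.truncated, r => max 1 r ^ (-γ)

theorem profile_eq_ofReal (γ : ℝ) (k : Kind) {r : ℝ} (hr : 0 < r) :
    profile γ k r = ENNReal.ofReal (profileReal γ k r) := by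
  cases k
  · exact ENNReal.ofReal_rpow_of_pos hr
  · exact ENNReal.ofReal_rpow_of_pos (lt_max_of_lt_left one_pos)

theorem profileReal_pos (γ : ℝ) (k : Kind) {r : ℝ} (hr : 0 < r) : 0 < profileReal γ k r := by
  cases k
  · exact Real.rpow_pos_of_pos hr _
  · exact Real.rpow_pos_of_pos (lt_max_of_lt_left one_pos) _

theorem profileReal_of_one_le (γ : ℝ) (k : Kind) {r : ℝ} (hr : 1 ≤ r) :
    profileReal γ k r = r ^ (-γ) := by
  cases k
  · rfl
  · simp [profileReal, hr]

theorem profileReal_le {γ : ℝ} (hγ : 0 ≤ γ) (k : Kind) {r : ℝ} (hr : 0 < r) :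
    profileReal γ k r ≤ r ^ (-γ) := by
  cases k
  · exact le_rfl
  · exact Real.rpow_le_rpow_of_nonpos hr (le_max_right _ _) (by linarith)

theorem profileReal_anti {γ : ℝ} (hγ : 0 ≤ γ) (k : Kind) {r s : ℝ} (hr : 0 < r) (hrs : r ≤ s) :
    profileReal γ k s ≤ profileReal γ k r := by
  cases k
  · exact Real.rpow_le_rpow_of_nonpos hr hrs (by linarith)
  · exact Real.rpow_le_rpow_of_nonpos (lt_max_of_lt_left one_pos) (max_le_max le_rfl hrs)
      (by linarith)

/-- Dilating the argument by `c ≥ 1` costs at most the factor `c ^ (-γ)`, for both kinds. -/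
theorem profileReal_le_mul {γ : ℝ} (hγ : 0 ≤ γ) (k : Kind) {r c : ℝ} (hr : 0 < r) (hc : 1 ≤ c) :
    c ^ (-γ) * profileReal γ k r ≤ profileReal γ k (c * r) := by
  have hc0 : 0 < c := by linarith
  cases k
  · exact (Real.mul_rpow hc0.le hr.le).ge
  · have h1 : (0 : ℝ) < max 1 r := lt_max_of_lt_left one_pos
    change c ^ (-γ) * max 1 r ^ (-γ) ≤ max 1 (c * r) ^ (-γ)
    rw [← Real.mul_rpow hc0.le h1.le]
    refine Real.rpow_le_rpow_of_nonpos (lt_max_of_lt_left one_pos) ?_ (by linarith)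
    rw [mul_max_of_nonneg _ _ hc0.le]
    exact max_le_max (by linarith) le_rfl

theorem profile_antitone {γ : ℝ} (hγ : 0 ≤ γ) (k : Kind) : Antitone (profile γ k) := by
  intro r s hrs
  cases k
  · simp only [profile, ENNReal.rpow_neg]
    gcongr
  · simp only [profile, ENNReal.rpow_neg]
    gcongr

@[fun_prop]
theorem measurable_profile (γ : ℝ) (k : Kind) : Measurable (profile γ k) := by
  cases k
  · change Measurable fun r : ℝ => ENNReal.ofReal r ^ (-γ)
    fun_prop
  · change Measurable fun r : ℝ => ENNReal.ofReal (max 1 r) ^ (-γ)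
    fun_prop

@[fun_prop]
theorem measurable_profileReal (γ : ℝ) (k : Kind) : Measurable (profileReal γ k) := by
  cases k
  · change Measurable fun r : ℝ => r ^ (-γ)
    fun_prop
  · change Measurable fun r : ℝ => (max 1 r) ^ (-γ)
    fun_prop

@[fun_prop]
theorem measurable_expDensity (m γ : ℝ) (k : Kind) :
    Measurable (expDensity d m (profile γ k)) := by
  unfold expDensity
  fun_prop

theorem radiallyAntitone_expDensity {m γ : ℝ} (hm : 0 < m) (hγ : 0 ≤ γ) (k : Kind) :
    RadiallyAntitone (expDensity d m (profile γ k)) := by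
  intro x y hxy
  unfold expDensity
  gcongr ?_ * ?_
  · apply ENNReal.ofReal_le_ofReal
    apply Real.exp_le_exp.mpr
    nlinarith
  · exact profile_antitone hγ k hxy

theorem expDensity_eq_ofReal (m γ : ℝ) (k : Kind) {x : E d} (hx : 0 < ‖x‖) :
    expDensity d m (profile γ k) x =
      ENNReal.ofReal (Real.exp (-m * ‖x‖) * profileReal γ k ‖x‖) := by
  rw [expDensity, profile_eq_ofReal γ k hx, ← ENNReal.ofReal_mul (Real.exp_pos _).le]

theorem expDensity_of_one_le (m γ : ℝ) (k : Kind) {x : E d} (hx : 1 ≤ ‖x‖) :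
    expDensity d m (profile γ k) x =
      ENNReal.ofReal (Real.exp (-m * ‖x‖) * ‖x‖ ^ (-γ)) := by
  rw [expDensity_eq_ofReal m γ k (by linarith), profileReal_of_one_le γ k hx]

theorem expDensity_le (m : ℝ) {γ : ℝ} (hγ : 0 ≤ γ) (k : Kind) {x : E d} (hx : 0 < ‖x‖) :
    expDensity d m (profile γ k) x ≤
      ENNReal.ofReal (Real.exp (-m * ‖x‖) * ‖x‖ ^ (-γ)) := by
  rw [expDensity_eq_ofReal m γ k hx]
  gcongr
  exact profileReal_le hγ k hx

theorem lintegral_expDensity_lt_top (hd : 1 ≤ d) {m γ : ℝ} (hm : 0 < m) (hγ : 0 ≤ γ)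
    (hγd : γ < d) (k : Kind) : ∫⁻ x : E d, expDensity d m (profile γ k) x < ∞ := by
  have h := lintegral_fun_norm hd (fun t => ENNReal.ofReal (Real.exp (-m * t)) * profile γ k t)
    (by fun_prop)
  change ∫⁻ x : E d, ENNReal.ofReal (Real.exp (-m * ‖x‖)) * profile γ k ‖x‖ < ∞
  rw [h]
  refine ENNReal.mul_lt_top (ENNReal.mul_lt_top (ENNReal.natCast_lt_top _) measure_ball_lt_top) ?_
  have hint : IntegrableOn (fun t : ℝ => t ^ ((d : ℝ) - γ - 1) * Real.exp (-m * t ^ (1 : ℝ)))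
      (Set.Ioi 0) :=
    integrableOn_rpow_mul_exp_neg_mul_rpow (by linarith) one_pos hm
  refine lt_of_le_of_lt (setLIntegral_mono' measurableSet_Ioi fun t (ht : 0 < t) => ?_)
    hint.lintegral_lt_top
  rw [profile_eq_ofReal γ k ht, ← ENNReal.ofReal_mul (Real.exp_pos _).le,
    ← ENNReal.ofReal_mul (by positivity)]
  apply ENNReal.ofReal_le_ofReal
  calc t ^ (d - 1) * (Real.exp (-m * t) * profileReal γ k t)
      ≤ t ^ (d - 1) * (Real.exp (-m * t) * t ^ (-γ)) := by
        gcongr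
        exact profileReal_le hγ k ht
    _ = t ^ ((d : ℝ) - γ - 1) * Real.exp (-m * t ^ (1 : ℝ)) := by
        rw [Real.rpow_one, ← Real.rpow_natCast, Nat.cast_sub hd, mul_comm (Real.exp _),
          ← mul_assoc, ← Real.rpow_add ht]
        congr 2
        push_cast; ring

@[fun_prop]
theorem measurable_convPow {f : E d → ℝ≥0∞} (hf : Measurable f) (n : ℕ) :
    Measurable (convPow f n) := by
  induction n using Nat.strong_induction_on with
  | _ n ih =>
    match n with
    | 0 => exact measurable_const
    | 1 => exact hf
    | n + 2 =>
      have h := ih (n + 1) (by omega)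
      refine Measurable.lintegral_prod_right' (f := fun p : E d × E d =>
        f (p.1 - p.2) * convPow f (n + 1) p.2) ?_
      fun_prop

theorem radiallyAntitone_convPow {f : E d → ℝ≥0∞} (hf : Measurable f) (hfa : RadiallyAntitone f)
    (n : ℕ) : RadiallyAntitone (convPow f n) := by
  induction n using Nat.strong_induction_on with
  | _ n ih =>
    match n with
    | 0 => exact fun _ _ _ => le_rfl
    | 1 => exact hfa
    | n + 2 => exact hfa.conv (ih (n + 1) (by omega)) hf (measurable_convPow hf _)

theorem lintegral_convPow {f : E d → ℝ≥0∞} (hf : Measurable f) (n : ℕ) :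
    ∫⁻ x, convPow f (n + 1) x = (∫⁻ x, f x) ^ (n + 1) := by
  induction n with
  | zero => simp [convPow]
  | succ n ih =>
    have hc := measurable_convPow hf (n + 1)
    change ∫⁻ x, ∫⁻ y, f (x - y) * convPow f (n + 1) y = _
    rw [lintegral_lintegral_swap (by fun_prop)]
    have : ∀ y, ∫⁻ x, f (x - y) * convPow f (n + 1) y =
        (∫⁻ x, f x) * convPow f (n + 1) y := by
      intro y
      rw [lintegral_mul_const _ (by fun_prop), lintegral_sub_right_eq_self]
    simp_rw [this]
    rw [lintegral_const_mul _ hc, ih, ← pow_succ']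

/-! ### The lower bound for the convolution powers -/

/-- The factor by which the lower bound grows with each convolution: `r ^ ρ₁` for `r ≤ 1` and
`r ^ ρ₂` for `r ≥ 1`. The faster decay at `0` is what makes the bound reproduce under convolution
on the whole of `(0, ∞)`. -/
noncomputable def lowerWeight (d : ℕ) (γ : ℝ) (k : Kind) (r : ℝ) : ℝ :=
  r ^ ρ₂ d γ * min r 1 ^ (ρ₁ d γ k - ρ₂ d γ)

theorem ρ₂_pos {γ : ℝ} (hγ : γ < ((d : ℝ) + 1) / 2) : 0 < ρ₂ d γ := by
  unfold ρ₂; linarith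

theorem ρ₂_le_ρ₁ (hd : 1 ≤ d) {γ : ℝ} (hγ : 0 ≤ γ) (k : Kind) :
    ρ₂ d γ ≤ ρ₁ d γ k := by
  have : (1 : ℝ) ≤ d := by exact_mod_cast hd
  cases k <;> simp only [ρ₁, ρ₂] <;> linarith

theorem lowerWeight_pos (d : ℕ) (γ : ℝ) (k : Kind) {r : ℝ} (hr : 0 < r) :
    0 < lowerWeight d γ k r := by
  have : 0 < min r 1 := lt_min hr one_pos
  unfold lowerWeight; positivity

theorem lowerWeight_of_one_le (d : ℕ) (γ : ℝ) (k : Kind) {r : ℝ} (hr : 1 ≤ r) :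
    lowerWeight d γ k r = r ^ ρ₂ d γ := by
  simp [lowerWeight, hr]

theorem measurable_lowerWeight (d : ℕ) (γ : ℝ) (k : Kind) : Measurable (lowerWeight d γ k) := by
  unfold lowerWeight; fun_prop

theorem lowerWeight_mono (hd : 1 ≤ d) {γ : ℝ} (hγ₀ : 0 ≤ γ)
    (hγ : γ < ((d : ℝ) + 1) / 2) (k : Kind) {r s : ℝ} (hr : 0 < r) (hrs : r ≤ s) :
    lowerWeight d γ k r ≤ lowerWeight d γ k s := by
  have h1 := (ρ₂_pos hγ).le
  have h2 := sub_nonneg.mpr (ρ₂_le_ρ₁ hd hγ₀ k)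
  have : 0 < min r 1 := lt_min hr one_pos
  have hs : 0 < s := hr.trans_le hrs
  unfold lowerWeight
  gcongr

theorem lowerWeight_mul_le (hd : 1 ≤ d) {γ : ℝ} (hγ₀ : 0 ≤ γ) (k : Kind) {r t : ℝ}
    (hr : 0 < r) (ht : 0 < t) (ht1 : t ≤ 1) :
    lowerWeight d γ k r * t ^ ρ₁ d γ k ≤ lowerWeight d γ k (r * t) := by
  have h2 := ρ₂_le_ρ₁ hd hγ₀ k
  have hm : 0 < min r 1 := lt_min hr one_pos
  have h3 : min r 1 * t ≤ min (r * t) 1 := by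
    rw [min_mul_of_nonneg _ _ ht.le, one_mul]
    exact min_le_min le_rfl ht1
  have h4 : t ^ ρ₁ d γ k = t ^ ρ₂ d γ * t ^ (ρ₁ d γ k - ρ₂ d γ) := by
    rw [← Real.rpow_add ht]; ring_nf
  unfold lowerWeight
  calc r ^ ρ₂ d γ * min r 1 ^ (ρ₁ d γ k - ρ₂ d γ) * t ^ ρ₁ d γ k
      = (r * t) ^ ρ₂ d γ * (min r 1 * t) ^ (ρ₁ d γ k - ρ₂ d γ) := by
        rw [h4, Real.mul_rpow hr.le ht.le, Real.mul_rpow hm.le ht.le]; ring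
    _ ≤ _ := by gcongr

/-- The case `n = 0` of `beta_density_le`, at the point `r t` of the segment `(0, r)`. The factor
`(u · min(u, 1)) ^ (D / 2)` with `u = r t (1 - t)` is, up to a constant, the volume of the section
of the region of integration. -/
theorem profile_mul_lowerWeight_le {D : ℕ} {γ : ℝ} (hγ : 0 ≤ γ) (k : Kind) {r t : ℝ}
    (hr : 0 < r) (ht : 0 < t) (ht1 : t < 1) :
    profileReal γ k r * lowerWeight (D + 1) γ k r * r⁻¹ *
        ((1 - t) ^ (ρ₁ (D + 1) γ k - 1) * t ^ (ρ₁ (D + 1) γ k - 1)) ≤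
      profileReal γ k (r * (1 - t)) * profileReal γ k (r * t) *
        (r * (t * (1 - t)) * min (r * (t * (1 - t))) 1) ^ ((D : ℝ) / 2) := by
  have ht' : 0 < 1 - t := by linarith
  obtain ⟨a, ha⟩ : ∃ a, a = t * (1 - t) := ⟨_, rfl⟩
  have ha0 : 0 < a := ha ▸ mul_pos ht ht'
  have ha1 : a ≤ 1 := by rw [ha]; nlinarith
  obtain ⟨μ, hμ⟩ : ∃ μ, μ = min r 1 := ⟨_, rfl⟩
  have hμ0 : 0 < μ := hμ ▸ lt_min hr one_pos
  have hmin : μ * a ≤ min (r * a) 1 := by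
    rw [hμ, min_mul_of_nonneg _ _ ha0.le, one_mul]
    exact min_le_min le_rfl ha1
  have hpow : r ^ ((D : ℝ) / 2) * μ ^ ((D : ℝ) / 2) * a ^ (D : ℝ) ≤
      (r * a * min (r * a) 1) ^ ((D : ℝ) / 2) := by
    calc r ^ ((D : ℝ) / 2) * μ ^ ((D : ℝ) / 2) * a ^ (D : ℝ)
        = (r * a * (μ * a)) ^ ((D : ℝ) / 2) := by
          have : a ^ (D : ℝ) = a ^ ((D : ℝ) / 2) * a ^ ((D : ℝ) / 2) := by
            rw [← Real.rpow_add ha0]; ring_nf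
          rw [Real.mul_rpow (by positivity) (by positivity), Real.mul_rpow hr.le ha0.le,
            Real.mul_rpow hμ0.le ha0.le, this]
          ring
      _ ≤ _ := by gcongr
  rw [← Real.mul_rpow ht'.le ht.le, mul_comm (1 - t) t, ← ha]
  have hv1 := profileReal_pos γ k (mul_pos hr ht')
  have hv2 := profileReal_pos γ k (mul_pos hr ht)
  refine le_trans ?_ (mul_le_mul_of_nonneg_left hpow (by positivity))
  cases k
  · apply le_of_eq
    have e1 : profileReal γ .power (r * (1 - t)) * profileReal γ .power (r * t) =
        r ^ (-γ) * r ^ (-γ) * a ^ (-γ) := by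
      simp only [profileReal]
      rw [Real.mul_rpow hr.le ht'.le, Real.mul_rpow hr.le ht.le, ha, Real.mul_rpow ht.le ht'.le]
      ring
    have e2 : ρ₁ (D + 1) γ .power - ρ₂ (D + 1) γ = (D : ℝ) / 2 := by
      simp only [ρ₁, ρ₂]; push_cast; ring
    have e3 : a ^ (ρ₁ (D + 1) γ .power - 1) = a ^ (-γ) * a ^ (D : ℝ) := by
      rw [← Real.rpow_add ha0]; simp only [ρ₁]; push_cast; ring_nf
    have e4 : r ^ ρ₂ (D + 1) γ = r ^ (-γ) * r ^ ((D : ℝ) / 2) * r := by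
      nth_rw 4 [← Real.rpow_one r]
      rw [← Real.rpow_add hr, ← Real.rpow_add hr]; simp only [ρ₂]; push_cast; ring_nf
    rw [e1, lowerWeight, e2, e3, e4, ← hμ]
    simp only [profileReal]
    field_simp
  · have h1 := profileReal_anti hγ .truncated (mul_pos hr ht')
      (show r * (1 - t) ≤ r by nlinarith)
    have h2 := profileReal_anti hγ .truncated (mul_pos hr ht) (show r * t ≤ r by nlinarith)
    have hv := profileReal_pos γ .truncated hr
    refine le_trans (le_of_eq ?_) (mul_le_mul_of_nonneg_right
      (mul_le_mul h1 h2 hv.le hv1.le) (by positivity))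
    have e2 : μ ^ (ρ₁ (D + 1) γ .truncated - ρ₂ (D + 1) γ) = μ ^ ((D : ℝ) / 2) * μ ^ γ := by
      rw [← Real.rpow_add hμ0]; simp only [ρ₁, ρ₂]; push_cast; ring_nf
    have e3 : ρ₁ (D + 1) γ .truncated - 1 = (D : ℝ) := by
      simp only [ρ₁]; push_cast; ring
    have e4 : r ^ ρ₂ (D + 1) γ = r ^ (-γ) * r ^ ((D : ℝ) / 2) * r := by
      nth_rw 4 [← Real.rpow_one r]
      rw [← Real.rpow_add hr, ← Real.rpow_add hr]; simp only [ρ₂]; push_cast; ring_nf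
    have e5 : profileReal γ .truncated r = r ^ (-γ) * μ ^ γ := by
      simp only [profileReal]
      have : r = max 1 r * μ := by
        rw [hμ, max_comm, max_mul_min, mul_one]
      nth_rw 2 [this]
      rw [Real.mul_rpow (by positivity) hμ0.le, mul_assoc, ← Real.rpow_add hμ0]
      simp
    rw [lowerWeight, ← hμ, e2, e3, e4, e5]
    field_simp

/-- One-dimensional form of the induction step of the lower bound: the integrand dominates a
multiple of a beta density. -/
theorem beta_density_le {D : ℕ} {γ : ℝ} (hγ : 0 ≤ γ) (k : Kind) (n : ℕ) {r s : ℝ}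
    (hr : 0 < r) (hs : 0 < s) (hsr : s < r) :
    profileReal γ k r * lowerWeight (D + 1) γ k r ^ (n + 1) *
        (r ^ (-(ρ₁ (D + 1) γ k + ρ₁ (D + 1) γ k * (n + 1) - 1)) *
        ((r - s) ^ (ρ₁ (D + 1) γ k - 1) * s ^ (ρ₁ (D + 1) γ k * (n + 1) - 1))) ≤
      profileReal γ k (r - s) * (profileReal γ k s * lowerWeight (D + 1) γ k s ^ n) *
        (s * (r - s) / r * min (s * (r - s) / r) 1) ^ ((D : ℝ) / 2) := by
  obtain ⟨t, rfl⟩ : ∃ t, s = r * t := ⟨s / r, by field_simp⟩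
  have ht : 0 < t := by
    by_contra h
    nlinarith
  have ht1 : t < 1 := by
    by_contra h
    nlinarith
  have ht' : 0 < 1 - t := by linarith
  have e1 : r - r * t = r * (1 - t) := by ring
  have e2 : r * t * (r * (1 - t)) / r = r * (t * (1 - t)) := by field_simp
  rw [e1, e2]
  have hA := lowerWeight_mul_le (d := D + 1) (by omega) hγ k hr ht ht1.le
  have hB := profile_mul_lowerWeight_le (D := D) hγ k hr ht ht1
  obtain ⟨ρ, hρ⟩ : ∃ ρ, ρ = ρ₁ (D + 1) γ k := ⟨_, rfl⟩
  rw [← hρ] at hA hB ⊢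
  have hw := lowerWeight_pos (D + 1) γ k hr
  have hwt := lowerWeight_pos (D + 1) γ k (mul_pos hr ht)
  have hv := profileReal_pos γ k hr
  have hv1 := profileReal_pos γ k (mul_pos hr ht')
  have hv2 := profileReal_pos γ k (mul_pos hr ht)
  have hAn := pow_le_pow_left₀ (by positivity) hA n
  have e3 : r ^ (-(ρ + ρ * (n + 1) - 1)) *
      ((r * (1 - t)) ^ (ρ - 1) * (r * t) ^ (ρ * (n + 1) - 1)) =
      r⁻¹ * ((1 - t) ^ (ρ - 1) * t ^ (ρ - 1)) * (t ^ ρ) ^ n := by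
    rw [Real.mul_rpow hr.le ht'.le, Real.mul_rpow hr.le ht.le]
    have e4 : r⁻¹ = r ^ (-(ρ + ρ * (n + 1) - 1)) * r ^ (ρ - 1) * r ^ (ρ * (n + 1) - 1) := by
      rw [← Real.rpow_add hr, ← Real.rpow_add hr, ← Real.rpow_neg_one]
      congr 1; ring
    have e5 : t ^ (ρ * (n + 1) - 1) = t ^ (ρ - 1) * (t ^ ρ) ^ n := by
      rw [← Real.rpow_natCast, ← Real.rpow_mul ht.le, ← Real.rpow_add ht]
      congr 1; ring
    rw [e4, e5]; ring
  rw [e3]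
  have hu : 0 < r * (t * (1 - t)) := by positivity
  have hmin : 0 < min (r * (t * (1 - t))) 1 := lt_min hu one_pos
  calc _ = (profileReal γ k r * lowerWeight (D + 1) γ k r * r⁻¹ *
        ((1 - t) ^ (ρ - 1) * t ^ (ρ - 1))) * (lowerWeight (D + 1) γ k r * t ^ ρ) ^ n := by
        rw [mul_pow]; ring
    _ ≤ _ := mul_le_mul hB hAn (by positivity) (by positivity)
    _ = _ := by ring

/-! ### Comparison of the constants in the lower bound -/

theorem one_le_threshold {a b : ℝ} (ha : 0 < a)
    (hab : a ^ (1 - Int.fract b) ≤ 8 * (⌈b⌉₊ : ℝ) ^ ⌊b⌋₊) :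
    1 ≤ threshold a b := by
  unfold threshold
  have h1 : 1 ≤ 8 * (⌈b⌉₊ : ℝ) ^ ⌊b⌋₊ / a ^ (1 - Int.fract b) := by
    rw [one_le_div (by positivity)]; exact hab
  have h2 : (1 : ℝ) ≤ (2 : ℝ) ^ (1 / a) * Real.exp (1 / Real.exp 1) :=
    one_le_mul_of_one_le_of_one_le (Real.one_le_rpow (by norm_num) (by positivity))
      (Real.one_le_exp (by positivity))
  exact one_le_mul_of_one_le_of_one_le (Real.one_le_rpow h1 (by positivity)) (one_le_pow₀ h2)

theorem one_le_r₀ (hd : 1 ≤ d) {γ : ℝ} (hγd : γ < d) (k : Kind) : 1 ≤ r₀ d γ k := by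
  cases k
  · have ha : 0 < (d : ℝ) - γ := by linarith
    have hc : (1 : ℝ) ≤ ⌈(d : ℝ) - γ⌉₊ := by exact_mod_cast Nat.one_le_ceil_iff.mpr ha
    refine one_le_threshold ha ?_
    have hf0 := Int.fract_nonneg ((d : ℝ) - γ)
    have hf1 := Int.fract_lt_one ((d : ℝ) - γ)
    rcases lt_or_ge ((d : ℝ) - γ) 1 with h | h
    · have h1 := Real.rpow_le_one ha.le h.le (z := 1 - Int.fract ((d : ℝ) - γ)) (by linarith)
      have h2 : (1 : ℝ) ≤ (⌈(d : ℝ) - γ⌉₊ : ℝ) ^ ⌊(d : ℝ) - γ⌋₊ := one_le_pow₀ hc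
      linarith
    · have h1 : ((d : ℝ) - γ) ^ (1 - Int.fract ((d : ℝ) - γ)) ≤ (d : ℝ) - γ := by
        nth_rw 3 [← Real.rpow_one ((d : ℝ) - γ)]
        exact Real.rpow_le_rpow_of_exponent_le h (by linarith)
      have h2 : (⌈(d : ℝ) - γ⌉₊ : ℝ) ≤ (⌈(d : ℝ) - γ⌉₊ : ℝ) ^ ⌊(d : ℝ) - γ⌋₊ :=
        le_self_pow₀ hc (Nat.one_le_iff_ne_zero.mp ((Nat.one_le_floor_iff _).mpr h))
      have h3 := Nat.le_ceil ((d : ℝ) - γ)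
      linarith
  · refine one_le_threshold one_pos ?_
    rw [Real.one_rpow, Nat.ceil_natCast, Nat.floor_natCast]
    have : (1 : ℝ) ≤ (d : ℝ) ^ d := one_le_pow₀ (by exact_mod_cast hd)
    linarith

theorem D₁_one (m γ C₃ : ℝ) (k : Kind) : D₁ 1 m γ C₃ k = 1 / 2 := by
  simp [D₁, constC]

theorem M₄_pos (hd : 1 < d) {C₃ : ℝ} (hC₃ : 1 ≤ C₃) : 0 < M₄ d C₃ := by
  have h1 : (1 : ℝ) < d := by exact_mod_cast hd
  have hG : 0 < Real.Gamma (((d : ℝ) - 1) / 2) := Real.Gamma_pos_of_pos (by linarith)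
  unfold M₄
  refine lt_min one_pos ?_
  positivity

/-- The constant `D₁` is at most the constant `K` with which the convolution step of the lower bound
can be carried out: `exp (-m / 2)` is the loss in the exponential (hence only `r₀ ≥ 1/2` matters),
`C₃⁻¹` and `√2 ^ (-γ)` are the losses in the two profiles, and the last factor is the volume of
the unit ball of `ℝ^D`. -/
theorem D₁_le {D : ℕ} (hD : 1 ≤ D) {m γ C₃ : ℝ} (hm : 0 < m)
    (hγ : γ < (((D + 1 : ℕ) : ℝ) + 1) / 2) (hC₃ : 1 ≤ C₃) (k : Kind) :
    D₁ (D + 1) m γ C₃ k ≤ Real.exp (-m * (1 / 2)) * (C₃⁻¹ * √2 ^ (-γ)) *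
      (√Real.pi ^ D / Real.Gamma (D / 2 + 1)) := by
  have hD0 : (1 : ℝ) ≤ D := by exact_mod_cast hD
  have hC0 : 0 < C₃ := one_pos.trans_le hC₃
  have hπ := Real.pi_pos
  have hΓ : 0 < Real.Gamma ((D : ℝ) / 2) := Real.Gamma_pos_of_pos (by positivity)
  have hr := one_le_r₀ (d := D + 1) (by omega)
    (show γ < ((D + 1 : ℕ) : ℝ) by push_cast at hγ ⊢; linarith) k
  have hexp : Real.exp (-m * r₀ (D + 1) γ k) ≤ Real.exp (-m * (1 / 2)) :=
    Real.exp_le_exp.mpr (by nlinarith)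
  have hcast : ((D + 1 : ℕ) : ℝ) - 1 = D := by push_cast; ring
  have hM : M₄ (D + 1) C₃ ≤
      2 ^ (D : ℝ) / (C₃ * Real.pi ^ ((D : ℝ) / 2 - 1) * Real.Gamma ((D : ℝ) / 2)) := by
    have h3 : (((D + 1 : ℕ) : ℝ) - 3) / 2 = (D : ℝ) / 2 - 1 := by push_cast; ring
    rw [M₄, hcast, h3]
    exact min_le_right _ _
  -- The loss `√2 ^ γ < 2 ^ ((D + 2) / 4)` is outweighed by the factor `4 π ^ (D - 1) / 2 ^ D`.
  have hnum : (2 : ℝ) ^ (D : ℝ) * √2 ^ γ ≤ 4 * Real.pi ^ ((D : ℝ) - 1) := by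
    obtain ⟨j, rfl⟩ : ∃ j, D = j + 1 := ⟨D - 1, by omega⟩
    have hs1 : (1 : ℝ) ≤ √2 := by rw [Real.one_le_sqrt]; norm_num
    have h1 : √2 ^ γ ≤ √2 ^ ((3 : ℝ) / 2 + 1 / 2 * j) := by
      apply Real.rpow_le_rpow_of_exponent_le hs1
      push_cast at hγ; linarith
    have h2 : √2 ^ ((3 : ℝ) / 2 + 1 / 2 * j) = √2 ^ ((3 : ℝ) / 2) * (√2 ^ ((1 : ℝ) / 2)) ^ j := by
      rw [Real.rpow_add (by positivity), Real.rpow_mul (by positivity), Real.rpow_natCast]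
    have h3 : √2 ^ ((3 : ℝ) / 2) ≤ 2 := by
      calc √2 ^ ((3 : ℝ) / 2) ≤ √2 ^ (2 : ℝ) :=
            Real.rpow_le_rpow_of_exponent_le hs1 (by norm_num)
        _ = 2 := by rw [Real.rpow_two, Real.sq_sqrt (by norm_num)]
    have h4 : √2 ^ ((1 : ℝ) / 2) ≤ 3 / 2 := by
      calc √2 ^ ((1 : ℝ) / 2) ≤ √2 ^ (1 : ℝ) :=
            Real.rpow_le_rpow_of_exponent_le hs1 (by norm_num)
        _ ≤ 3 / 2 := by
            rw [Real.rpow_one, Real.sqrt_le_iff]; norm_num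
    have h5 : ((j + 1 : ℕ) : ℝ) - 1 = j := by push_cast; ring
    rw [h5, Real.rpow_natCast, Real.rpow_natCast]
    calc (2 : ℝ) ^ (j + 1) * √2 ^ γ ≤ 2 ^ (j + 1) * (2 * (3 / 2) ^ j) := by
          rw [h2] at h1
          refine mul_le_mul_of_nonneg_left (h1.trans ?_) (by positivity)
          gcongr
      _ = 4 * 3 ^ j := by
          have : (3 : ℝ) ^ j = 2 ^ j * (3 / 2) ^ j := by rw [← mul_pow]; norm_num
          rw [this]; ring
      _ ≤ 4 * Real.pi ^ j := by
          have := Real.pi_gt_three.le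
          gcongr
  have hγ2 : 0 < √2 ^ γ := by positivity
  have hfin : 2 ^ (D : ℝ) / (C₃ * Real.pi ^ ((D : ℝ) / 2 - 1) * Real.Gamma ((D : ℝ) / 2)) /
      (D * 2) ≤ C₃⁻¹ * √2 ^ (-γ) * (√Real.pi ^ D / Real.Gamma (D / 2 + 1)) := by
    have h1 : √Real.pi ^ D = Real.pi ^ ((D : ℝ) - 1) / Real.pi ^ ((D : ℝ) / 2 - 1) := by
      rw [← Real.rpow_sub hπ, Real.sqrt_eq_rpow, ← Real.rpow_natCast, ← Real.rpow_mul hπ.le]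
      congr 1; ring
    rw [h1, Real.Gamma_add_one (by positivity), Real.rpow_neg (by positivity)]
    have h2 : 0 < Real.pi ^ ((D : ℝ) / 2 - 1) := by positivity
    have e1 : C₃⁻¹ * (√2 ^ γ)⁻¹ * (Real.pi ^ ((D : ℝ) - 1) / Real.pi ^ ((D : ℝ) / 2 - 1) /
        ((D : ℝ) / 2 * Real.Gamma ((D : ℝ) / 2))) = 4 * Real.pi ^ ((D : ℝ) - 1) *
        (C₃ * √2 ^ γ * Real.pi ^ ((D : ℝ) / 2 - 1) * (2 * D) * Real.Gamma ((D : ℝ) / 2))⁻¹ := by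
      field_simp; norm_num
    have e2 : 2 ^ (D : ℝ) / (C₃ * Real.pi ^ ((D : ℝ) / 2 - 1) * Real.Gamma ((D : ℝ) / 2)) /
      (D * 2) = 2 ^ (D : ℝ) * √2 ^ γ *
        (C₃ * √2 ^ γ * Real.pi ^ ((D : ℝ) / 2 - 1) * (2 * D) * Real.Gamma ((D : ℝ) / 2))⁻¹ := by
      field_simp
    rw [e1, e2]
    gcongr
  rw [D₁, if_neg (by omega), constC, if_neg (by omega), hcast]
  calc Real.exp (-m * r₀ (D + 1) γ k) / D * M₄ (D + 1) C₃ / 2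
      ≤ Real.exp (-m * (1 / 2)) / D *
        (2 ^ (D : ℝ) / (C₃ * Real.pi ^ ((D : ℝ) / 2 - 1) * Real.Gamma ((D : ℝ) / 2))) / 2 := by
        have := (M₄_pos (d := D + 1) (by omega) hC₃).le
        gcongr
    _ = Real.exp (-m * (1 / 2)) * (2 ^ (D : ℝ) /
        (C₃ * Real.pi ^ ((D : ℝ) / 2 - 1) * Real.Gamma ((D : ℝ) / 2)) / (D * 2)) := by
        field_simp
    _ ≤ Real.exp (-m * (1 / 2)) * (C₃⁻¹ * √2 ^ (-γ) *
        (√Real.pi ^ D / Real.Gamma (D / 2 + 1))) := by gcongr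
    _ = _ := by ring

theorem D₁_pos (hd : 1 ≤ d) {m γ C₃ : ℝ} (hC₃ : 1 ≤ C₃) (k : Kind) :
    0 < D₁ d m γ C₃ k := by
  rcases hd.eq_or_lt with rfl | h
  · rw [D₁_one]; norm_num
  · have h1 : (1 : ℝ) < d := by exact_mod_cast h
    have hM := M₄_pos h hC₃
    have hc : 0 < constC d m γ k := by
      rw [constC, if_neg h.ne']
      have : 0 < (d : ℝ) - 1 := by linarith
      positivity
    rw [D₁, if_neg h.ne']
    positivity

theorem D₁_le_one (hd : 1 ≤ d) {m γ C₃ : ℝ} (hm : 0 < m) (hγd : γ < d)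
    (k : Kind) : D₁ d m γ C₃ k ≤ 1 := by
  rcases hd.eq_or_lt with rfl | h
  · rw [D₁_one]; norm_num
  · have h1 : (2 : ℝ) ≤ d := by exact_mod_cast h
    have hM : M₄ d C₃ ≤ 1 := min_le_left _ _
    have hr := one_le_r₀ hd hγd k
    rw [D₁, if_neg h.ne', constC, if_neg h.ne']
    have he : Real.exp (-m * r₀ d γ k) ≤ 1 := Real.exp_le_one_iff.mpr (by nlinarith)
    have hc : Real.exp (-m * r₀ d γ k) / ((d : ℝ) - 1) ≤ 1 := by
      rw [div_le_one (by linarith)]; linarith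
    have hc0 : 0 ≤ Real.exp (-m * r₀ d γ k) / ((d : ℝ) - 1) :=
      div_nonneg (Real.exp_pos _).le (by linarith)
    nlinarith

/-! ### The convolution step of the lower bound -/

theorem profileReal_le_of_isDoublingConst {γ C₃ : ℝ} {k : Kind}
    (hC₃ : IsDoublingConst (profile γ k) C₃) {r : ℝ} (hr : 0 < r) :
    profileReal γ k r ≤ C₃ * profileReal γ k (2 * r) := by
  have h := hC₃.2 r hr
  have h0 : 0 ≤ C₃ := zero_le_one.trans hC₃.1
  have h2 := profileReal_pos γ k (show 0 < 2 * r by positivity)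
  rwa [profile_eq_ofReal γ k hr, profile_eq_ofReal γ k (by positivity),
    ← ENNReal.ofReal_mul h0, ENNReal.ofReal_le_ofReal_iff (by positivity)] at h

/-- Lower bound for the integral over the section at height `s` in cylindrical coordinates about the
segment from `0` to `x`, `‖x‖ = r`. With `u = s (r - s) / r` it is restricted to
`‖z‖² ≤ u · min(u, 1)`. There `‖z‖² ≤ u` keeps the detour `‖y‖ + ‖x - y‖ - r ≤ ‖z‖² / (2 u)` below
`1/2`, and `‖z‖ ≤ u ≤ min(s, r - s)` keeps the two distances within a factor `√2` of `s` and
`r - s`. -/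
theorem le_lintegral_slice {D : ℕ} {m γ C₃ : ℝ} (hm : 0 < m) (hγ₀ : 0 ≤ γ)
    (hγ : γ < (((D + 1 : ℕ) : ℝ) + 1) / 2) {k : Kind} (hC₃ : IsDoublingConst (profile γ k) C₃)
    (n : ℕ) {c r s : ℝ} (hc : 0 ≤ c) (hs : 0 < s) (hsr : s < r) :
    ENNReal.ofReal (D₁ (D + 1) m γ C₃ k * c * Real.exp (-m * r) *
      (profileReal γ k (r - s) *
        (profileReal γ k s * lowerWeight (D + 1) γ k s ^ n) *
        (s * (r - s) / r * min (s * (r - s) / r) 1) ^ ((D : ℝ) / 2))) ≤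
    ∫⁻ z : E D, ENNReal.ofReal (Real.exp (-m * √((r - s) ^ 2 + ‖z‖ ^ 2)) *
          profileReal γ k √((r - s) ^ 2 + ‖z‖ ^ 2)) *
        ENNReal.ofReal (c * Real.exp (-m * √(s ^ 2 + ‖z‖ ^ 2)) *
          profileReal γ k √(s ^ 2 + ‖z‖ ^ 2) * lowerWeight (D + 1) γ k √(s ^ 2 + ‖z‖ ^ 2) ^ n) := by
  have hrs : 0 < r - s := by linarith
  have hr : 0 < r := by linarith
  have hv1 := profileReal_pos γ k hrs
  have hv2 := profileReal_pos γ k hs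
  have hw := lowerWeight_pos (D + 1) γ k hs
  rcases Nat.eq_zero_or_pos D with rfl | hD
  · have hz : ∀ z : E 0, ‖z‖ = 0 := fun z => by rw [Subsingleton.elim z 0, norm_zero]
    have hvol : volume (Set.univ : Set (E 0)) = 1 := by
      have : (Set.univ : Set (E 0)) = {0} := by ext z; simp [Subsingleton.elim z 0]
      rw [this, volume_euclideanSpace_eq_dirac]
      simp
    simp only [hz, ne_eq, OfNat.ofNat_ne_zero, not_false_eq_true, zero_pow, add_zero,
      Real.sqrt_sq hs.le, Real.sqrt_sq hrs.le, lintegral_const, hvol, mul_one]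
    rw [← ENNReal.ofReal_mul (by positivity)]
    apply ENNReal.ofReal_le_ofReal
    rw [zero_add, D₁_one]
    have : Real.exp (-m * r) = Real.exp (-m * (r - s)) * Real.exp (-m * s) := by
      rw [← Real.exp_add]; congr 1; ring
    rw [this]
    simp only [CharP.cast_eq_zero, zero_div, Real.rpow_zero, mul_one]
    have : 0 ≤ c * (Real.exp (-m * (r - s)) * Real.exp (-m * s)) *
      (profileReal γ k (r - s) * (profileReal γ k s * lowerWeight (0 + 1) γ k s ^ n)) := by
      positivity
    rw [zero_add] at this
    linarith
  · obtain ⟨u, hu⟩ : ∃ u, u = s * (r - s) / r := ⟨_, rfl⟩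
    have hu0 : 0 < u := hu ▸ by positivity
    have hus : u ≤ s := by
      rw [hu, div_le_iff₀ hr]; nlinarith
    have hurs : u ≤ r - s := by
      rw [hu, div_le_iff₀ hr]; nlinarith
    rw [← hu]
    obtain ⟨q, hq⟩ : ∃ q, q = u * min u 1 := ⟨_, rfl⟩
    have hmin : 0 < min u 1 := lt_min hu0 one_pos
    have hq0 : 0 < q := hq ▸ mul_pos hu0 hmin
    have hq1 : q ≤ u := by rw [hq]; nlinarith [min_le_right u 1]
    have hq2 : q ≤ u ^ 2 := by rw [hq]; nlinarith [min_le_left u 1]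
    rw [← hq]
    have hpt : ∀ z ∈ Metric.closedBall (0 : E D) (√q),
        ENNReal.ofReal (Real.exp (-m * (1 / 2)) * (C₃⁻¹ * √2 ^ (-γ)) * (c * Real.exp (-m * r) *
          (profileReal γ k (r - s) * (profileReal γ k s * lowerWeight (D + 1) γ k s ^ n)))) ≤
        ENNReal.ofReal (Real.exp (-m * √((r - s) ^ 2 + ‖z‖ ^ 2)) *
          profileReal γ k √((r - s) ^ 2 + ‖z‖ ^ 2)) *
        ENNReal.ofReal (c * Real.exp (-m * √(s ^ 2 + ‖z‖ ^ 2)) *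
          profileReal γ k √(s ^ 2 + ‖z‖ ^ 2) *
            lowerWeight (D + 1) γ k √(s ^ 2 + ‖z‖ ^ 2) ^ n) := by
      intro z hz
      have hz2 : ‖z‖ ^ 2 ≤ q := by
        rw [mem_closedBall_zero_iff] at hz
        calc ‖z‖ ^ 2 ≤ √q ^ 2 := by gcongr
          _ = q := Real.sq_sqrt hq0.le
      obtain ⟨y, hy⟩ : ∃ y, y = ‖z‖ ^ 2 := ⟨_, rfl⟩
      have hy0 : 0 ≤ y := hy ▸ by positivity
      rw [← hy] at hz2 ⊢
      have ha : √(s ^ 2 + y) ≤ s + y / (2 * s) := by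
        refine Real.sqrt_le_iff.mpr ⟨by positivity, ?_⟩
        have : (s + y / (2 * s)) ^ 2 = s ^ 2 + y + (y / (2 * s)) ^ 2 := by field_simp; ring
        rw [this]; nlinarith [sq_nonneg (y / (2 * s))]
      have hb : √((r - s) ^ 2 + y) ≤ (r - s) + y / (2 * (r - s)) := by
        refine Real.sqrt_le_iff.mpr ⟨by positivity, ?_⟩
        have : ((r - s) + y / (2 * (r - s))) ^ 2 =
            (r - s) ^ 2 + y + (y / (2 * (r - s))) ^ 2 := by field_simp; ring
        rw [this]; nlinarith [sq_nonneg (y / (2 * (r - s)))]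
      have hab : √((r - s) ^ 2 + y) + √(s ^ 2 + y) ≤ r + 1 / 2 := by
        have h1 : y / (2 * s) + y / (2 * (r - s)) = y / (2 * u) := by
          rw [hu]; field_simp; ring
        have h2 : y / (2 * u) ≤ 1 / 2 := by
          rw [div_le_div_iff₀ (by positivity) (by norm_num)]; linarith
        linarith
      have ha1 : s ≤ √(s ^ 2 + y) := Real.le_sqrt_of_sq_le (by linarith)
      have hb1 : r - s ≤ √((r - s) ^ 2 + y) := Real.le_sqrt_of_sq_le (by linarith)
      have ha2 : √(s ^ 2 + y) ≤ √2 * s := by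
        refine Real.sqrt_le_iff.mpr ⟨by positivity, ?_⟩
        rw [mul_pow, Real.sq_sqrt (by norm_num)]; nlinarith
      have hb2 : √((r - s) ^ 2 + y) ≤ 2 * (r - s) := by
        refine Real.sqrt_le_iff.mpr ⟨by positivity, ?_⟩
        nlinarith
      have hC0 : 0 < C₃ := one_pos.trans_le hC₃.1
      have hvb : C₃⁻¹ * profileReal γ k (r - s) ≤ profileReal γ k √((r - s) ^ 2 + y) := by
        rw [inv_mul_le_iff₀ hC0]
        refine (profileReal_le_of_isDoublingConst hC₃ hrs).trans ?_
        gcongr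
        exact profileReal_anti hγ₀ k (by linarith) hb2
      have hva : √2 ^ (-γ) * profileReal γ k s ≤ profileReal γ k √(s ^ 2 + y) :=
        (profileReal_le_mul hγ₀ k hs (by rw [Real.one_le_sqrt]; norm_num)).trans
          (profileReal_anti hγ₀ k (by linarith) ha2)
      have hwa : lowerWeight (D + 1) γ k s ≤ lowerWeight (D + 1) γ k √(s ^ 2 + y) :=
        lowerWeight_mono (by omega) hγ₀ hγ k hs ha1
      have he : Real.exp (-m * (1 / 2)) * Real.exp (-m * r) ≤
          Real.exp (-m * √((r - s) ^ 2 + y)) * Real.exp (-m * √(s ^ 2 + y)) := by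
        rw [← Real.exp_add, ← Real.exp_add]
        apply Real.exp_le_exp.mpr
        nlinarith
      have hva0 := profileReal_pos γ k (hs.trans_le ha1)
      have hvb0 := profileReal_pos γ k (hrs.trans_le hb1)
      rw [← ENNReal.ofReal_mul (by positivity)]
      apply ENNReal.ofReal_le_ofReal
      calc _ = c * (Real.exp (-m * (1 / 2)) * Real.exp (-m * r)) *
            (C₃⁻¹ * profileReal γ k (r - s)) * (√2 ^ (-γ) * profileReal γ k s) *
            lowerWeight (D + 1) γ k s ^ n := by ring
        _ ≤ c * (Real.exp (-m * √((r - s) ^ 2 + y)) * Real.exp (-m * √(s ^ 2 + y))) *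
            profileReal γ k √((r - s) ^ 2 + y) * profileReal γ k √(s ^ 2 + y) *
            lowerWeight (D + 1) γ k √(s ^ 2 + y) ^ n := by gcongr
        _ = _ := by ring
    refine le_trans ?_ (setLIntegral_le_lintegral (Metric.closedBall (0 : E D) (√q)) _)
    refine le_trans ?_ (setLIntegral_mono' measurableSet_closedBall hpt)
    have : Nonempty (Fin D) := ⟨⟨0, hD⟩⟩
    have hG : 0 < Real.Gamma ((D : ℝ) / 2 + 1) := Real.Gamma_pos_of_pos (by positivity)
    have hC0 : 0 < C₃ := one_pos.trans_le hC₃.1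
    rw [setLIntegral_const, EuclideanSpace.volume_closedBall, Fintype.card_fin,
      ← ENNReal.ofReal_pow (Real.sqrt_nonneg _), ← ENNReal.ofReal_mul (by positivity),
      ← ENNReal.ofReal_mul (by positivity)]
    apply ENNReal.ofReal_le_ofReal
    have hsq : √q ^ D = q ^ ((D : ℝ) / 2) := by
      rw [Real.sqrt_eq_rpow, ← Real.rpow_natCast, ← Real.rpow_mul hq0.le]
      congr 1; ring
    rw [hsq]
    have hK := D₁_le hD hm hγ hC₃.1 k
    calc _ = D₁ (D + 1) m γ C₃ k * (c * Real.exp (-m * r) *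
          (profileReal γ k (r - s) * (profileReal γ k s * lowerWeight (D + 1) γ k s ^ n)) *
            q ^ ((D : ℝ) / 2)) := by ring
      _ ≤ _ := mul_le_mul_of_nonneg_right hK (by positivity)
      _ = _ := by ring

/-- The constant in the lower bound for `f^{(n+1)⋆}`. -/
noncomputable def lowerConst (d : ℕ) (m γ C₃ : ℝ) (k : Kind) (n : ℕ) : ℝ :=
  D₁ d m γ C₃ k ^ n * (Real.Gamma (ρ₁ d γ k) ^ (n + 1) / Real.Gamma (ρ₁ d γ k * (n + 1)))

/-- Pointwise lower bound for the convolution powers, by induction with `le_lintegral_slice`,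
`beta_density_le` and the beta integral. -/
theorem le_convPow (hd : 1 ≤ d) {m γ C₃ : ℝ} (hm : 0 < m) (hγ₀ : 0 ≤ γ)
    (hγ : γ < ((d : ℝ) + 1) / 2) {k : Kind} (hC₃ : IsDoublingConst (profile γ k) C₃)
    (n : ℕ) (x : E d) (hx : 0 < ‖x‖) :
    ENNReal.ofReal (lowerConst d m γ C₃ k n * Real.exp (-m * ‖x‖) * profileReal γ k ‖x‖ *
      lowerWeight d γ k ‖x‖ ^ n) ≤ convPow (expDensity d m (profile γ k)) (n + 1) x := by
  have hρ : 0 < ρ₁ d γ k := (ρ₂_pos hγ).trans_le (ρ₂_le_ρ₁ hd hγ₀ k)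
  have hD := D₁_pos hd (m := m) (γ := γ) hC₃.1 k
  have hΓ : 0 < Real.Gamma (ρ₁ d γ k) := Real.Gamma_pos_of_pos hρ
  obtain ⟨D, rfl⟩ : ∃ D, d = D + 1 := ⟨d - 1, by omega⟩
  induction n generalizing x with
  | zero =>
    change _ ≤ expDensity _ m (profile γ k) x
    rw [expDensity_eq_ofReal m γ k hx]
    apply ENNReal.ofReal_le_ofReal
    simp [lowerConst, div_self hΓ.ne']
  | succ n ih =>
    have hc : 0 ≤ lowerConst (D + 1) m γ C₃ k n := by
      have : 0 < Real.Gamma (ρ₁ (D + 1) γ k * (n + 1)) := Real.Gamma_pos_of_pos (by positivity)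
      unfold lowerConst; positivity
    set c := lowerConst (D + 1) m γ C₃ k n with hcdef
    obtain ⟨r, hr⟩ : ∃ r, r = ‖x‖ := ⟨_, rfl⟩
    have hr0 : 0 < r := hr ▸ hx
    have he : ‖r⁻¹ • x‖ = 1 := by
      rw [norm_smul, norm_inv, Real.norm_of_nonneg hr0.le, hr, inv_mul_cancel₀ (hr ▸ hr0.ne')]
    have hxe : r • r⁻¹ • x = x := by rw [smul_smul, mul_inv_cancel₀ hr0.ne', one_smul]
    have hmw := measurable_lowerWeight (D + 1) γ k
    have hcyl := lintegral_cylindrical (r⁻¹ • x) he r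
      (fun a b => ENNReal.ofReal (Real.exp (-m * a) * profileReal γ k a) *
        ENNReal.ofReal (c * Real.exp (-m * b) * profileReal γ k b *
          lowerWeight (D + 1) γ k b ^ n)) (by unfold Function.uncurry; fun_prop)
    rw [hxe] at hcyl
    have hle : ∫⁻ y, ENNReal.ofReal (Real.exp (-m * ‖x - y‖) * profileReal γ k ‖x - y‖) *
        ENNReal.ofReal (c * Real.exp (-m * ‖y‖) * profileReal γ k ‖y‖ *
          lowerWeight (D + 1) γ k ‖y‖ ^ n) ≤
        convPow (expDensity (D + 1) m (profile γ k)) (n + 1 + 1) x := by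
      -- The formula for `f` in terms of `profileReal` may fail at the origin.
      have hne : ∀ a : E (D + 1), ∀ᵐ y : E (D + 1), y ≠ a := fun a =>
        compl_mem_ae_iff.mpr (measure_singleton a)
      refine lintegral_mono_ae ?_
      filter_upwards [hne 0, hne x] with y hy0 hyx
      have h1 : 0 < ‖x - y‖ := norm_pos_iff.mpr (sub_ne_zero.mpr hyx.symm)
      rw [expDensity_eq_ofReal m γ k h1]
      gcongr
      exact ih y (norm_pos_iff.mpr hy0)
    refine le_trans ?_ hle
    rw [hcyl]
    refine le_trans ?_ (setLIntegral_le_lintegral (Set.Ioo 0 r) _)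
    set ρ := ρ₁ (D + 1) γ k with hρdef
    have hbeta := lintegral_beta (α := ρ) (β := ρ * (n + 1)) hρ (by positivity) hr0
    have hpt : ∀ s ∈ Set.Ioo 0 r,
        ENNReal.ofReal (D₁ (D + 1) m γ C₃ k * c * Real.exp (-m * r) *
          (profileReal γ k r * lowerWeight (D + 1) γ k r ^ (n + 1) *
            r ^ (-(ρ + ρ * (n + 1) - 1)))) *
          ENNReal.ofReal ((r - s) ^ (ρ - 1) * s ^ (ρ * (n + 1) - 1)) ≤
        ∫⁻ z : E D, ENNReal.ofReal (Real.exp (-m * √((r - s) ^ 2 + ‖z‖ ^ 2)) *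
          profileReal γ k √((r - s) ^ 2 + ‖z‖ ^ 2)) *
        ENNReal.ofReal (c * Real.exp (-m * √(s ^ 2 + ‖z‖ ^ 2)) *
          profileReal γ k √(s ^ 2 + ‖z‖ ^ 2) *
            lowerWeight (D + 1) γ k √(s ^ 2 + ‖z‖ ^ 2) ^ n) := by
      intro s hs
      refine le_trans ?_ (le_lintegral_slice hm hγ₀ hγ hC₃ n hc hs.1 hs.2)
      have hv := profileReal_pos γ k hr0
      have hw := lowerWeight_pos (D + 1) γ k hr0
      rw [← ENNReal.ofReal_mul (by positivity)]
      apply ENNReal.ofReal_le_ofReal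
      have := beta_density_le (D := D) hγ₀ k n hr0 hs.1 hs.2
      rw [mul_assoc]
      refine mul_le_mul_of_nonneg_left ?_ (by positivity)
      rw [mul_assoc]
      exact this
    refine le_trans ?_ (setLIntegral_mono' measurableSet_Ioo hpt)
    rw [lintegral_const_mul _ (by fun_prop), hbeta]
    have hv := profileReal_pos γ k hr0
    have hw := lowerWeight_pos (D + 1) γ k hr0
    rw [← ENNReal.ofReal_mul (by positivity), ← hr]
    apply ENNReal.ofReal_le_ofReal
    apply le_of_eq
    have hG1 : 0 < Real.Gamma (ρ * (n + 1)) := Real.Gamma_pos_of_pos (by positivity)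
    have hG2 : 0 < Real.Gamma (ρ * (n + 1 + 1)) := Real.Gamma_pos_of_pos (by positivity)
    have e1 : r ^ (-(ρ + ρ * (n + 1) - 1)) * r ^ (ρ + ρ * (n + 1) - 1) = 1 := by
      rw [← Real.rpow_add hr0]; simp
    have e2 : ρ + ρ * (n + 1) = ρ * (n + 1 + 1) := by ring
    have e3 : lowerConst (D + 1) m γ C₃ k (n + 1) = D₁ (D + 1) m γ C₃ k * c *
        (Real.Gamma ρ * Real.Gamma (ρ * (n + 1)) / Real.Gamma (ρ * (n + 1 + 1))) := by
      rw [hcdef, lowerConst, lowerConst, ← hρdef]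
      push_cast
      field_simp
      ring
    rw [e3]
    calc _ = D₁ (D + 1) m γ C₃ k * c * Real.exp (-m * r) *
          (profileReal γ k r * lowerWeight (D + 1) γ k r ^ (n + 1)) *
          (Real.Gamma ρ * Real.Gamma (ρ * (n + 1)) / Real.Gamma (ρ * (n + 1 + 1))) *
          (r ^ (-(ρ + ρ * (n + 1) - 1)) * r ^ (ρ + ρ * (n + 1) - 1)) := by rw [e1]; ring
      _ = _ := by rw [← e2]; ring

/-! ### Integration over the angle -/

/-- Spherical coordinates with axis `e`: `ρ` is the distance to `0` and `θ` is the angle to `e`.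
They come from cylindrical coordinates, polar coordinates in the orthogonal complement of `e`, and
polar coordinates in a half-plane. -/
theorem lintegral_spherical {D : ℕ} (hD : 1 ≤ D) (e : E (D + 1)) (he : ‖e‖ = 1) (r : ℝ)
    (G : ℝ → ℝ → ℝ≥0∞) (hG : Measurable (Function.uncurry G)) :
    ∫⁻ y : E (D + 1), G ‖r • e - y‖ ‖y‖ =
      D * volume (Metric.ball (0 : E D) 1) *
        ∫⁻ ρ in Set.Ioi (0 : ℝ), ∫⁻ θ in Set.Ioo 0 Real.pi,
          ENNReal.ofReal (ρ * (ρ * Real.sin θ) ^ (D - 1)) *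
            G (√((r - ρ * Real.cos θ) ^ 2 + (ρ * Real.sin θ) ^ 2)) ρ := by
  have hG' : ∀ {α : Type} [MeasurableSpace α] {a b : α → ℝ}, Measurable a → Measurable b →
      Measurable fun x => G (a x) (b x) := fun ha hb => hG.comp (ha.prodMk hb)
  rw [lintegral_cylindrical e he r G hG]
  have h1 : ∀ s : ℝ, ∫⁻ z : E D, G (√((r - s) ^ 2 + ‖z‖ ^ 2)) (√(s ^ 2 + ‖z‖ ^ 2)) =
      D * volume (Metric.ball (0 : E D) 1) * ∫⁻ t in Set.Ioi (0 : ℝ),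
        ENNReal.ofReal (t ^ (D - 1)) * G (√((r - s) ^ 2 + t ^ 2)) (√(s ^ 2 + t ^ 2)) := by
    intro s
    exact lintegral_fun_norm hD
      (fun t => G (√((r - s) ^ 2 + t ^ 2)) (√(s ^ 2 + t ^ 2)))
      (hG' (by fun_prop) (by fun_prop))
  simp_rw [h1]
  let H : ℝ × ℝ → ℝ≥0∞ := fun p => (Set.Ioi (0 : ℝ)).indicator (fun t =>
    ENNReal.ofReal (t ^ (D - 1)) * G (√((r - p.1) ^ 2 + t ^ 2)) (√(p.1 ^ 2 + t ^ 2))) p.2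
  have hH : Measurable H := by
    have : H = (Prod.snd ⁻¹' Set.Ioi (0 : ℝ)).indicator (fun p : ℝ × ℝ =>
        ENNReal.ofReal (p.2 ^ (D - 1)) *
          G (√((r - p.1) ^ 2 + p.2 ^ 2)) (√(p.1 ^ 2 + p.2 ^ 2))) := by
      ext p; simp [H, Set.indicator]
    rw [this]
    refine Measurable.indicator (Measurable.mul (by fun_prop) (hG' (by fun_prop) (by fun_prop)))
      (measurable_snd measurableSet_Ioi)
  have h2 : ∀ s : ℝ, ∫⁻ t in Set.Ioi (0 : ℝ),
        ENNReal.ofReal (t ^ (D - 1)) * G (√((r - s) ^ 2 + t ^ 2)) (√(s ^ 2 + t ^ 2)) =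
      ∫⁻ t, H (s, t) := fun s => (lintegral_indicator measurableSet_Ioi _).symm
  simp_rw [h2]
  have hm : Measurable fun s => ∫⁻ t, H (s, t) := hH.lintegral_prod_right'
  rw [lintegral_const_mul _ hm, ← lintegral_prod _ hH.aemeasurable, ← Measure.volume_eq_prod,
    ← lintegral_comp_polarCoord_symm]
  congr 1
  have ht : polarCoord.target = Set.Ioi (0 : ℝ) ×ˢ Set.Ioo (-Real.pi) Real.pi := rfl
  have hs : ∀ p : ℝ × ℝ, polarCoord.symm p = (p.1 * Real.cos p.2, p.1 * Real.sin p.2) :=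
    fun p => rfl
  simp_rw [hs]
  rw [ht, Measure.volume_eq_prod, ← Measure.prod_restrict, lintegral_prod]
  · refine setLIntegral_congr_fun measurableSet_Ioi fun ρ hρ => ?_
    have hρ : 0 < ρ := hρ
    rw [← lintegral_indicator measurableSet_Ioo, ← lintegral_indicator measurableSet_Ioo]
    refine lintegral_congr fun θ => ?_
    by_cases hθ : θ ∈ Set.Ioo 0 Real.pi
    · have hθ' : θ ∈ Set.Ioo (-Real.pi) Real.pi := ⟨by linarith [hθ.1, Real.pi_pos], hθ.2⟩
      have hsin : 0 < ρ * Real.sin θ := mul_pos hρ (Real.sin_pos_of_mem_Ioo hθ)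
      have hsq : √((ρ * Real.cos θ) ^ 2 + (ρ * Real.sin θ) ^ 2) = ρ := by
        have : (ρ * Real.cos θ) ^ 2 + (ρ * Real.sin θ) ^ 2 = ρ ^ 2 := by
          nlinarith [Real.sin_sq_add_cos_sq θ]
        rw [this, Real.sqrt_sq hρ.le]
      rw [Set.indicator_of_mem hθ, Set.indicator_of_mem hθ']
      simp only [H]
      rw [Set.indicator_of_mem (show ρ * Real.sin θ ∈ Set.Ioi (0 : ℝ) from hsin), hsq, smul_eq_mul,
        ← mul_assoc, ← ENNReal.ofReal_mul hρ.le]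
    · rw [Set.indicator_of_notMem hθ]
      by_cases hθ' : θ ∈ Set.Ioo (-Real.pi) Real.pi
      · rw [Set.indicator_of_mem hθ']
        have hθ0 : θ ≤ 0 := by
          by_contra h
          exact hθ ⟨not_le.mp h, hθ'.2⟩
        have hsin : ¬ (ρ * Real.sin θ ∈ Set.Ioi (0 : ℝ)) := by
          have := Real.sin_nonpos_of_nonpos_of_neg_pi_le hθ0 hθ'.1.le
          simp only [Set.mem_Ioi, not_lt]
          nlinarith
        simp only [H]
        rw [Set.indicator_of_notMem hsin, smul_zero]
      · rw [Set.indicator_of_notMem hθ']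
  · refine Measurable.aemeasurable ?_
    have h1 : Measurable fun p : ℝ × ℝ => ENNReal.ofReal p.1 := by fun_prop
    have h2 : Measurable fun p : ℝ × ℝ => (p.1 * Real.cos p.2, p.1 * Real.sin p.2) := by fun_prop
    exact h1.smul (hH.comp h2)

/-- The exponent in the integral defining `M₃`. -/
noncomputable def angularDecay (t : ℝ) : ℝ := t ^ 2 / √(1 + t ^ 2)

@[fun_prop]
theorem measurable_angularDecay : Measurable angularDecay := by
  unfold angularDecay; fun_prop

theorem sub_one_le_angularDecay {t : ℝ} (ht : 0 ≤ t) : t - 1 ≤ angularDecay t := by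
  have h1 : √(1 + t ^ 2) ≤ 1 + t := Real.sqrt_le_iff.mpr ⟨by linarith, by nlinarith⟩
  have h2 : 0 < √(1 + t ^ 2) := Real.sqrt_pos.mpr (by positivity)
  rw [angularDecay, le_div_iff₀ h2]
  rcases le_total t 1 with h | h
  · nlinarith
  · nlinarith

/-- The constant `M₃` bounds the integral of `exp (-(m / π²) angularDecay ‖z‖)` over `ℝ^D`. -/
theorem lintegral_angularDecay_le {D : ℕ} (hD : 1 ≤ D) {m : ℝ} (hm : 0 < m) :
    D * volume (Metric.ball (0 : E D) 1) * ∫⁻ t in Set.Ioi (0 : ℝ),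
      ENNReal.ofReal (t ^ (D - 1) * Real.exp (-(m / Real.pi ^ 2) * angularDecay t)) ≤
    ENNReal.ofReal (M₃ (D + 1) m) := by
  have hD0 : (0 : ℝ) < D := by exact_mod_cast hD
  have : Nonempty (Fin D) := ⟨⟨0, hD⟩⟩
  have hcast : ((D + 1 : ℕ) : ℝ) - 1 = D := by push_cast; ring
  have hcast2 : ((D + 1 : ℕ) : ℝ) - 2 = ((D - 1 : ℕ) : ℝ) := by
    rw [Nat.cast_sub hD]; push_cast; ring
  have hc : 0 < m / Real.pi ^ 2 := by positivity
  set c := m / Real.pi ^ 2 with hcdef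
  have hint : IntegrableOn (fun t => t ^ (D - 1) * Real.exp (-c * angularDecay t))
      (Set.Ioi 0) := by
    have h1 : IntegrableOn (fun t : ℝ => t ^ (((D - 1 : ℕ) : ℝ)) * Real.exp (-c * t ^ (1 : ℝ)))
      (Set.Ioi 0) :=
      integrableOn_rpow_mul_exp_neg_mul_rpow
        (lt_of_lt_of_le (by norm_num : (-1 : ℝ) < 0) (Nat.cast_nonneg _)) one_pos hc
    refine Integrable.mono' (h1.const_mul (Real.exp c)) (by fun_prop) ?_
    refine (ae_restrict_iff' measurableSet_Ioi).mpr (ae_of_all _ fun t ht => ?_)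
    have ht : 0 < t := ht
    rw [Real.norm_of_nonneg (by positivity), Real.rpow_one, Real.rpow_natCast, mul_left_comm,
      ← Real.exp_add]
    gcongr
    nlinarith [sub_one_le_angularDecay ht.le]
  rw [← ofReal_integral_eq_lintegral_ofReal hint
    ((ae_restrict_iff' measurableSet_Ioi).mpr (ae_of_all _ fun t ht => by
      have ht : 0 < t := ht
      positivity)), EuclideanSpace.volume_ball, Fintype.card_fin, ENNReal.ofReal_one, one_pow,
    one_mul, ← ENNReal.ofReal_natCast, ← ENNReal.ofReal_mul hD0.le,
    ← ENNReal.ofReal_mul (by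
      have : 0 < Real.Gamma ((D : ℝ) / 2 + 1) := Real.Gamma_pos_of_pos (by positivity)
      positivity)]
  apply ENNReal.ofReal_le_ofReal
  rw [M₃, hcast, hcast2]
  refine le_trans (le_of_eq ?_) (le_max_right _ _)
  congr 1
  · rw [Real.Gamma_add_one (by positivity)]
    have : √Real.pi ^ D = Real.pi ^ ((D : ℝ) / 2) := by
      rw [Real.sqrt_eq_rpow, ← Real.rpow_natCast, ← Real.rpow_mul Real.pi_pos.le]
      congr 1; ring
    rw [this]
    field_simp
  · refine setIntegral_congr_fun measurableSet_Ioi fun t ht => ?_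
    simp only [Real.rpow_natCast, angularDecay, ← hcdef]
    ring

/-- A point at distance `ρ` from the origin and at angle `θ` to `x`, `|x| = r`, is further from
`x` than `r - ρ` by an amount that is at least quadratic in `θ` for small `θ`. -/
theorem add_angularDecay_le {r ρ θ : ℝ} (hρ : 1 ≤ ρ) (hρr : ρ ≤ r - 1) (hθ : 0 < θ)
    (hθπ : θ < Real.pi) :
    (r - ρ) + angularDecay (√(r * ρ / (r - ρ)) * θ) / Real.pi ^ 2 ≤
      √((r - ρ * Real.cos θ) ^ 2 + (ρ * Real.sin θ) ^ 2) := by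
  have hπ := Real.pi_gt_three
  obtain ⟨δ, hδ⟩ : ∃ δ, δ = r - ρ := ⟨_, rfl⟩
  have hδ1 : 1 ≤ δ := by linarith
  have hr : r = δ + ρ := by linarith
  rw [← hδ]
  obtain ⟨t, ht⟩ : ∃ t, t = √(r * ρ / δ) * θ := ⟨_, rfl⟩
  rw [← ht]
  have ht2 : δ * t ^ 2 = r * ρ * θ ^ 2 := by
    rw [ht, mul_pow, Real.sq_sqrt (by rw [hr]; positivity)]
    field_simp
  have hsin : θ / Real.pi ≤ Real.sin (θ / 2) := by
    have := Real.mul_le_sin (x := θ / 2) (by linarith) (by linarith)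
    calc θ / Real.pi = 2 / Real.pi * (θ / 2) := by ring
      _ ≤ _ := this
  have hcos : Real.cos θ = 1 - 2 * Real.sin (θ / 2) ^ 2 := by
    have := Real.cos_two_mul (θ / 2)
    have h2 := Real.sin_sq_add_cos_sq (θ / 2)
    rw [show 2 * (θ / 2) = θ by ring] at this
    linarith
  have hsin2 : θ ^ 2 / Real.pi ^ 2 ≤ Real.sin (θ / 2) ^ 2 := by
    rw [← div_pow]
    gcongr
  have hdist : (r - ρ * Real.cos θ) ^ 2 + (ρ * Real.sin θ) ^ 2 =
      δ ^ 2 + 4 * (r * ρ) * Real.sin (θ / 2) ^ 2 := by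
    have : (r - ρ * Real.cos θ) ^ 2 + (ρ * Real.sin θ) ^ 2 =
        r ^ 2 - 2 * r * ρ * Real.cos θ + ρ ^ 2 := by
      nlinarith [Real.sin_sq_add_cos_sq θ]
    rw [this, hcos, hδ]; ring
  rw [hdist]
  have hA1 : angularDecay t ≤ t ^ 2 := by
    rw [angularDecay]
    apply div_le_self (by positivity)
    rw [Real.one_le_sqrt]; nlinarith [sq_nonneg t]
  have hA2 : angularDecay t ^ 2 ≤ t ^ 2 := by
    rw [angularDecay, div_pow, Real.sq_sqrt (by positivity),
      div_le_iff₀ (by positivity)]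
    nlinarith [sq_nonneg t]
  have hA0 : 0 ≤ angularDecay t := by unfold angularDecay; positivity
  apply Real.le_sqrt_of_sq_le
  have hrρ : 0 ≤ r * ρ := by rw [hr]; positivity
  have h1 : 4 * (δ * t ^ 2 / Real.pi ^ 2) ≤ 4 * (r * ρ) * Real.sin (θ / 2) ^ 2 := by
    rw [ht2]
    calc 4 * (r * ρ * θ ^ 2 / Real.pi ^ 2) = 4 * (r * ρ) * (θ ^ 2 / Real.pi ^ 2) := by ring
      _ ≤ _ := by gcongr
  have h2 : (δ + angularDecay t / Real.pi ^ 2) ^ 2 ≤ δ ^ 2 + 4 * (δ * t ^ 2 / Real.pi ^ 2) := by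
    have e1 : (δ + angularDecay t / Real.pi ^ 2) ^ 2 = δ ^ 2 + (2 * δ * angularDecay t +
        angularDecay t ^ 2 / Real.pi ^ 2) / Real.pi ^ 2 := by field_simp; ring
    have e2 : angularDecay t ^ 2 / Real.pi ^ 2 ≤ angularDecay t ^ 2 :=
      div_le_self (by positivity) (by nlinarith)
    rw [e1]
    have e3 : 4 * (δ * t ^ 2 / Real.pi ^ 2) = (4 * δ * t ^ 2) / Real.pi ^ 2 := by ring
    rw [e3]
    gcongr
    nlinarith [sq_nonneg t]
  linarith

/-- Integral over the angle at distance `ρ` from `0`. The substitution `t = √(r ρ / (r - ρ)) θ`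
makes the bound in `add_angularDecay_le` independent of `r` and `ρ`. -/
theorem lintegral_angle_le {D : ℕ} (hD : 1 ≤ D) {m r ρ : ℝ} (hm : 0 < m) (hρ : 1 ≤ ρ)
    (hρr : ρ ≤ r - 1) :
    ∫⁻ θ in Set.Ioo 0 Real.pi, ENNReal.ofReal (ρ * (ρ * Real.sin θ) ^ (D - 1)) *
      ENNReal.ofReal (Real.exp (-m * √((r - ρ * Real.cos θ) ^ 2 + (ρ * Real.sin θ) ^ 2))) ≤
    ENNReal.ofReal (Real.exp (-m * (r - ρ)) * (ρ * (r - ρ) / r) ^ ((D : ℝ) / 2)) *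
      ∫⁻ t in Set.Ioi (0 : ℝ),
        ENNReal.ofReal (t ^ (D - 1) * Real.exp (-(m / Real.pi ^ 2) * angularDecay t)) := by
  have hδ : 0 < r - ρ := by linarith
  have hr : 0 < r := by linarith
  have hρ0 : 0 < ρ := by linarith
  obtain ⟨c, hc⟩ : ∃ c, c = √(r * ρ / (r - ρ)) := ⟨_, rfl⟩
  have hc0 : 0 < c := hc ▸ Real.sqrt_pos.mpr (by positivity)
  let F : ℝ → ℝ≥0∞ := (Set.Ioi (0 : ℝ)).indicator fun t =>
    ENNReal.ofReal (t ^ (D - 1) * Real.exp (-(m / Real.pi ^ 2) * angularDecay t))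
  have hF : Measurable F := Measurable.indicator (by fun_prop) measurableSet_Ioi
  have hpt : ∀ θ ∈ Set.Ioo 0 Real.pi, ENNReal.ofReal (ρ * (ρ * Real.sin θ) ^ (D - 1)) *
      ENNReal.ofReal (Real.exp (-m * √((r - ρ * Real.cos θ) ^ 2 + (ρ * Real.sin θ) ^ 2))) ≤
      ENNReal.ofReal (Real.exp (-m * (r - ρ)) * (ρ ^ D * c⁻¹ ^ (D - 1))) * F (c * θ) := by
    intro θ hθ
    have hs0 := Real.sin_pos_of_mem_Ioo hθ
    have hθ0 : 0 < θ := hθ.1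
    have hcθ : 0 < c * θ := mul_pos hc0 hθ0
    simp only [F]
    rw [Set.indicator_of_mem (show c * θ ∈ Set.Ioi (0 : ℝ) from hcθ),
      ← ENNReal.ofReal_mul (by positivity), ← ENNReal.ofReal_mul (by positivity)]
    apply ENNReal.ofReal_le_ofReal
    have h1 : Real.exp (-m * √((r - ρ * Real.cos θ) ^ 2 + (ρ * Real.sin θ) ^ 2)) ≤
        Real.exp (-m * (r - ρ)) * Real.exp (-(m / Real.pi ^ 2) * angularDecay (c * θ)) := by
      rw [← Real.exp_add]
      apply Real.exp_le_exp.mpr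
      have := add_angularDecay_le hρ hρr hθ.1 hθ.2
      rw [← hc] at this
      have h2 : -m * (r - ρ) + -(m / Real.pi ^ 2) * angularDecay (c * θ) =
        -m * ((r - ρ) + angularDecay (c * θ) / Real.pi ^ 2) := by ring
      rw [h2]
      nlinarith
    have h3 : ρ * (ρ * Real.sin θ) ^ (D - 1) ≤ ρ ^ D * θ ^ (D - 1) := by
      obtain ⟨j, rfl⟩ : ∃ j, D = j + 1 := ⟨D - 1, by omega⟩
      simp only [Nat.add_sub_cancel]
      have := Real.sin_le hθ.1.le
      calc ρ * (ρ * Real.sin θ) ^ j ≤ ρ * (ρ * θ) ^ j := by gcongr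
        _ = ρ ^ (j + 1) * θ ^ j := by rw [mul_pow]; ring
    calc _ ≤ ρ ^ D * θ ^ (D - 1) * (Real.exp (-m * (r - ρ)) *
          Real.exp (-(m / Real.pi ^ 2) * angularDecay (c * θ))) :=
          mul_le_mul h3 h1 (Real.exp_pos _).le (by positivity)
      _ = _ := by
          rw [mul_pow c, inv_pow]
          field_simp
  refine (setLIntegral_mono' measurableSet_Ioo hpt).trans ?_
  refine (setLIntegral_le_lintegral _ _).trans ?_
  have hFc : Measurable fun θ => F (c * θ) := hF.comp (by fun_prop)
  rw [lintegral_const_mul _ hFc, lintegral_comp_mul_left F hc0,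
    ← mul_assoc, ← ENNReal.ofReal_mul (by positivity), lintegral_indicator measurableSet_Ioi]
  apply le_of_eq
  congr 2
  rw [mul_assoc]
  congr 1
  have h4 : c⁻¹ ^ (D - 1) * c⁻¹ = c⁻¹ ^ D := by
    rw [← pow_succ, Nat.sub_add_cancel hD]
  rw [mul_assoc, h4, ← mul_pow]
  have h5 : ρ * c⁻¹ = √(ρ * (r - ρ) / r) := by
    rw [hc, ← Real.sqrt_inv]
    nth_rw 1 [← Real.sqrt_sq hρ0.le]
    rw [← Real.sqrt_mul (by positivity)]
    congr 1
    field_simp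
  rw [h5, Real.sqrt_eq_rpow, ← Real.rpow_natCast, ← Real.rpow_mul (by positivity)]
  congr 1; ring

/-! ### The main part of the convolution integral -/

/-- The part of the convolution integral that produces the leading term: `y` is at distance at
least `1` from `0`, is nearer to `0` than `x` by at least `1`, and is nearer to `x` than `0` is. -/
def mainRegion (x : E d) : Set (E d) :=
  {y | 1 ≤ ‖y‖ ∧ ‖y‖ ≤ ‖x‖ - 1 ∧ ‖x - y‖ < ‖x‖}

theorem measurableSet_mainRegion (x : E d) : MeasurableSet (mainRegion x) := by
  have h : MeasurableSet ({y : E d | 1 ≤ ‖y‖} ∩ ({y | ‖y‖ ≤ ‖x‖ - 1} ∩ {y | ‖x - y‖ < ‖x‖})) :=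
    (measurableSet_le (by fun_prop) (by fun_prop)).inter
      ((measurableSet_le (by fun_prop) (by fun_prop)).inter
        (measurableSet_lt (by fun_prop) (by fun_prop)))
  exact h

theorem one_le_D₂ (d : ℕ) (m : ℝ) : 1 ≤ D₂ d m := by
  unfold D₂
  split_ifs
  · exact le_rfl
  · exact le_max_left _ _

/-- Integrating out the angle over the main region leaves a one-dimensional integral along the
segment from `0` to `x`. -/
theorem lintegral_mainRegion_le {D : ℕ} {m : ℝ} (hm : 0 < m) (x : E (D + 1)) (hx : 2 ≤ ‖x‖)
    (Φ : ℝ → ℝ≥0∞) (hΦ : Measurable Φ) :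
    ∫⁻ y in mainRegion x, ENNReal.ofReal (Real.exp (-m * ‖x - y‖)) * Φ ‖y‖ ≤
      ∫⁻ s in Set.Ioo 0 ‖x‖, ENNReal.ofReal (D₂ (D + 1) m * (Real.exp (-m * (‖x‖ - s)) *
        (s * (‖x‖ - s) / ‖x‖) ^ ((D : ℝ) / 2))) * Φ s := by
  obtain ⟨r, hr⟩ : ∃ r, r = ‖x‖ := ⟨_, rfl⟩
  rw [← hr] at hx ⊢
  have hr0 : 0 < r := by linarith
  have he : ‖r⁻¹ • x‖ = 1 := by
    rw [norm_smul, norm_inv, Real.norm_of_nonneg hr0.le, hr, inv_mul_cancel₀ (hr ▸ hr0.ne')]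
  have hxe : r • r⁻¹ • x = x := by rw [smul_smul, mul_inv_cancel₀ hr0.ne', one_smul]
  rcases Nat.eq_zero_or_pos D with rfl | hD
  · let G : ℝ → ℝ → ℝ≥0∞ := fun a b => {p : ℝ × ℝ | 1 ≤ p.2 ∧ p.2 ≤ r - 1 ∧ p.1 < r}.indicator
      (fun p => ENNReal.ofReal (Real.exp (-m * p.1)) * Φ p.2) (a, b)
    have hset : MeasurableSet {p : ℝ × ℝ | 1 ≤ p.2 ∧ p.2 ≤ r - 1 ∧ p.1 < r} := by
      have h : MeasurableSet ({p : ℝ × ℝ | 1 ≤ p.2} ∩ ({p | p.2 ≤ r - 1} ∩ {p | p.1 < r})) :=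
        (measurableSet_le (by fun_prop) (by fun_prop)).inter
          ((measurableSet_le (by fun_prop) (by fun_prop)).inter
            (measurableSet_lt (by fun_prop) (by fun_prop)))
      exact h
    have hG : Measurable (Function.uncurry G) :=
      Measurable.indicator (by fun_prop) hset
    have hcyl := lintegral_cylindrical (r⁻¹ • x) he r G hG
    rw [hxe] at hcyl
    have h1 : ∫⁻ y in mainRegion x, ENNReal.ofReal (Real.exp (-m * ‖x - y‖)) * Φ ‖y‖ =
        ∫⁻ y, G ‖x - y‖ ‖y‖ := by
      rw [← lintegral_indicator (measurableSet_mainRegion x)]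
      refine lintegral_congr fun y => ?_
      simp only [G, Set.indicator, mainRegion, ← hr]
      rfl
    have hz : ∀ z : E 0, ‖z‖ = 0 := fun z => by rw [Subsingleton.elim z 0, norm_zero]
    have hvol : volume (Set.univ : Set (E 0)) = 1 := by
      rw [volume_euclideanSpace_eq_dirac]; simp
    rw [h1, hcyl]
    simp only [hz, ne_eq, OfNat.ofNat_ne_zero, not_false_eq_true, zero_pow, add_zero,
      lintegral_const, hvol, mul_one, Real.sqrt_sq_eq_abs]
    rw [← lintegral_indicator measurableSet_Ioo]
    refine lintegral_mono fun s => ?_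
    simp only [G]
    by_cases hs : (|r - s|, |s|) ∈ {p : ℝ × ℝ | 1 ≤ p.2 ∧ p.2 ≤ r - 1 ∧ p.1 < r}
    · obtain ⟨hs1, hs2, hs3⟩ := hs
      simp only at hs1 hs2 hs3
      have hs0 : 0 < s := by
        have := le_abs_self (r - s); linarith
      rw [abs_of_pos hs0] at hs1 hs2
      have hrs : 0 < r - s := by linarith
      rw [abs_of_pos hrs, abs_of_pos hs0, Set.indicator_of_mem (by
          rw [abs_of_pos hrs] at hs3
          exact ⟨hs1, hs2, hs3⟩),
        Set.indicator_of_mem (show s ∈ Set.Ioo 0 r from ⟨hs0, by linarith⟩)]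
      simp [D₂]
    · rw [Set.indicator_of_notMem hs]
      exact zero_le
  · let G : ℝ → ℝ → ℝ≥0∞ := fun a b =>
      ENNReal.ofReal (Real.exp (-m * a)) * (Set.Icc 1 (r - 1)).indicator Φ b
    have hΦ' : Measurable ((Set.Icc 1 (r - 1)).indicator Φ) := hΦ.indicator measurableSet_Icc
    have hG : Measurable (Function.uncurry G) := by
      unfold Function.uncurry
      simp only [G]
      fun_prop
    have hsph := lintegral_spherical hD (r⁻¹ • x) he r G hG
    rw [hxe] at hsph
    have h1 : ∫⁻ y in mainRegion x, ENNReal.ofReal (Real.exp (-m * ‖x - y‖)) * Φ ‖y‖ ≤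
        ∫⁻ y, G ‖x - y‖ ‖y‖ := by
      rw [← lintegral_indicator (measurableSet_mainRegion x)]
      refine lintegral_mono fun y => ?_
      by_cases hy : y ∈ mainRegion x
      · rw [Set.indicator_of_mem hy]
        simp only [G]
        rw [Set.indicator_of_mem (show ‖y‖ ∈ Set.Icc 1 (r - 1) from ⟨hy.1, hr ▸ hy.2.1⟩)]
      · rw [Set.indicator_of_notMem hy]
        exact zero_le
    refine h1.trans ?_
    rw [hsph]
    set J := ∫⁻ t in Set.Ioi (0 : ℝ),
      ENNReal.ofReal (t ^ (D - 1) * Real.exp (-(m / Real.pi ^ 2) * angularDecay t)) with hJ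
    have hJM := lintegral_angularDecay_le hD hm
    rw [← hJ] at hJM
    set c := (D : ℝ≥0∞) * volume (Metric.ball (0 : E D) 1) with hc
    have hctop : c ≠ ∞ := ENNReal.mul_ne_top (ENNReal.natCast_ne_top _) measure_ball_lt_top.ne
    rw [← lintegral_const_mul' _ _ hctop, ← lintegral_indicator measurableSet_Ioi,
      ← lintegral_indicator measurableSet_Ioo]
    refine lintegral_mono fun s => ?_
    by_cases hs : s ∈ Set.Icc 1 (r - 1)
    · have hs0 : 0 < s := by linarith [hs.1]
      have hs1 : s < r := by linarith [hs.2]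
      have hrs : 0 < r - s := by linarith
      rw [Set.indicator_of_mem (show s ∈ Set.Ioi (0 : ℝ) from hs0),
        Set.indicator_of_mem (show s ∈ Set.Ioo 0 r from ⟨hs0, hs1⟩)]
      simp only [G]
      rw [Set.indicator_of_mem hs]
      have h2 : ∫⁻ θ in Set.Ioo 0 Real.pi, ENNReal.ofReal (s * (s * Real.sin θ) ^ (D - 1)) *
          (ENNReal.ofReal (Real.exp (-m * √((r - s * Real.cos θ) ^ 2 + (s * Real.sin θ) ^ 2))) *
            Φ s) ≤ ENNReal.ofReal (Real.exp (-m * (r - s)) * (s * (r - s) / r) ^ ((D : ℝ) / 2)) *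
              J * Φ s := by
        simp_rw [← mul_assoc]
        rw [lintegral_mul_const _ (by fun_prop)]
        gcongr
        exact lintegral_angle_le hD hm hs.1 hs.2
      have hD2 : D₂ (D + 1) m = M₃ (D + 1) m := by
        rw [D₂, if_neg (by omega)]
      calc _ ≤ c * (ENNReal.ofReal (Real.exp (-m * (r - s)) *
            (s * (r - s) / r) ^ ((D : ℝ) / 2)) * J * Φ s) := by gcongr
        _ = (c * J) * ENNReal.ofReal (Real.exp (-m * (r - s)) *
            (s * (r - s) / r) ^ ((D : ℝ) / 2)) * Φ s := by ring
        _ ≤ ENNReal.ofReal (M₃ (D + 1) m) * ENNReal.ofReal (Real.exp (-m * (r - s)) *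
            (s * (r - s) / r) ^ ((D : ℝ) / 2)) * Φ s := by gcongr
        _ = _ := by
            have hM : 0 ≤ M₃ (D + 1) m := zero_le_one.trans (le_max_left _ _)
            rw [hD2, ← ENNReal.ofReal_mul hM]
    · have : (Set.Ioi (0 : ℝ)).indicator (fun s => c * ∫⁻ θ in Set.Ioo 0 Real.pi,
          ENNReal.ofReal (s * (s * Real.sin θ) ^ (D - 1)) *
            G (√((r - s * Real.cos θ) ^ 2 + (s * Real.sin θ) ^ 2)) s) s = 0 := by
        apply Set.indicator_apply_eq_zero.mpr
        intro _
        simp only [G]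
        rw [Set.indicator_of_notMem hs]
        simp
      rw [this]
      exact zero_le

/-- The convolution over the main region of `f` with `exp (-m‖y‖) ‖y‖ ^ (b - γ)`. The exponentials
combine to `exp (-m‖x‖)`, and a beta integral remains. -/
theorem lintegral_mainRegion_mul_le (hd : 1 ≤ d) {m γ : ℝ} (hm : 0 < m) (hγ₀ : 0 ≤ γ)
    (hγ : γ < ((d : ℝ) + 1) / 2) (k : Kind) (x : E d) (hx : 2 ≤ ‖x‖) {b : ℝ} (hb : 0 ≤ b) :
    ∫⁻ y in mainRegion x, expDensity d m (profile γ k) (x - y) *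
        ENNReal.ofReal (Real.exp (-m * ‖y‖) * (‖y‖ ^ (-γ) * ‖y‖ ^ b)) ≤
      ENNReal.ofReal (D₂ d m * (Real.Gamma (ρ₂ d γ) * Real.Gamma (ρ₂ d γ + b) /
        Real.Gamma (ρ₂ d γ + (ρ₂ d γ + b))) *
        (Real.exp (-m * ‖x‖) * (‖x‖ ^ (-γ) * ‖x‖ ^ (ρ₂ d γ + b)))) := by
  obtain ⟨D, rfl⟩ : ∃ D, d = D + 1 := ⟨d - 1, by omega⟩
  have hq := ρ₂_pos hγ
  have hqD : ρ₂ (D + 1) γ = (D : ℝ) / 2 + 1 - γ := by unfold ρ₂; push_cast; ring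
  obtain ⟨q, hqdef⟩ : ∃ q, q = ρ₂ (D + 1) γ := ⟨_, rfl⟩
  rw [← hqdef] at hq hqD ⊢
  obtain ⟨r, hr⟩ : ∃ r, r = ‖x‖ := ⟨_, rfl⟩
  have hr0 : 0 < r := by linarith
  have hD2 : 0 ≤ D₂ (D + 1) m := zero_le_one.trans (one_le_D₂ _ _)
  let Φ : ℝ → ℝ≥0∞ := fun s =>
    ENNReal.ofReal ((r - s) ^ (-γ) * (Real.exp (-m * s) * (s ^ (-γ) * s ^ b)))
  have hΦ : Measurable Φ := by simp only [Φ]; fun_prop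
  have h1 : ∀ y ∈ mainRegion x, expDensity (D + 1) m (profile γ k) (x - y) *
        ENNReal.ofReal (Real.exp (-m * ‖y‖) * (‖y‖ ^ (-γ) * ‖y‖ ^ b)) ≤
      ENNReal.ofReal (Real.exp (-m * ‖x - y‖)) * Φ ‖y‖ := by
    intro y hy
    have hry : 0 < r - ‖y‖ := by linarith [hy.2.1]
    have hxy : r - ‖y‖ ≤ ‖x - y‖ := hr ▸ norm_sub_norm_le x y
    refine (mul_le_mul_left (expDensity_le m hγ₀ k (hry.trans_le hxy)) _).trans ?_
    simp only [Φ]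
    rw [← ENNReal.ofReal_mul (by positivity), ← ENNReal.ofReal_mul (by positivity), mul_assoc]
    apply ENNReal.ofReal_le_ofReal
    exact mul_le_mul_of_nonneg_left (mul_le_mul_of_nonneg_right
      (Real.rpow_le_rpow_of_nonpos hry hxy (by linarith)) (by positivity)) (by positivity)
  refine (setLIntegral_mono' (measurableSet_mainRegion x) h1).trans
    ((lintegral_mainRegion_le hm x hx Φ hΦ).trans ?_)
  rw [← hr]
  have h2 : ∀ s ∈ Set.Ioo 0 r, ENNReal.ofReal (D₂ (D + 1) m * (Real.exp (-m * (r - s)) *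
        (s * (r - s) / r) ^ ((D : ℝ) / 2))) * Φ s =
      ENNReal.ofReal (D₂ (D + 1) m * Real.exp (-m * r) * r ^ (-((D : ℝ) / 2))) *
        ENNReal.ofReal ((r - s) ^ (q - 1) * s ^ (q + b - 1)) := by
    intro s hs
    have hs0 : 0 < s := hs.1
    have hrs : 0 < r - s := by linarith [hs.2]
    simp only [Φ]
    rw [← ENNReal.ofReal_mul (by positivity), ← ENNReal.ofReal_mul (by positivity)]
    congr 1
    have e1 : (r - s) ^ (q - 1) = (r - s) ^ ((D : ℝ) / 2) * (r - s) ^ (-γ) := by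
      rw [← Real.rpow_add hrs, hqD]; congr 1; ring
    have e2 : s ^ (q + b - 1) = s ^ ((D : ℝ) / 2) * s ^ (-γ) * s ^ b := by
      rw [← Real.rpow_add hs0, ← Real.rpow_add hs0, hqD]; congr 1; ring
    have e3 : (s * (r - s) / r) ^ ((D : ℝ) / 2) =
        s ^ ((D : ℝ) / 2) * (r - s) ^ ((D : ℝ) / 2) * r ^ (-((D : ℝ) / 2)) := by
      rw [Real.div_rpow (by positivity) hr0.le, Real.mul_rpow hs0.le hrs.le, Real.rpow_neg hr0.le]
      rfl
    have e4 : Real.exp (-m * r) = Real.exp (-m * (r - s)) * Real.exp (-m * s) := by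
      rw [← Real.exp_add]; congr 1; ring
    rw [e1, e2, e3, e4]; ring
  rw [setLIntegral_congr_fun measurableSet_Ioo h2, lintegral_const_mul _ (by fun_prop),
    lintegral_beta hq (by linarith) hr0, ← ENNReal.ofReal_mul (by positivity)]
  apply ENNReal.ofReal_le_ofReal
  apply le_of_eq
  have e5 : r ^ (-((D : ℝ) / 2)) * r ^ (q + (q + b) - 1) = r ^ (-γ) * r ^ (q + b) := by
    rw [← Real.rpow_add hr0, ← Real.rpow_add hr0]; congr 1; linarith
  rw [← e5]; ring

/-! ### The upper bound for the convolution powers -/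

theorem IsStepConst.le_mul {f : E d → ℝ≥0∞} (hf : RadiallyAntitone f) {C₁ : ℝ}
    (hC₁ : IsStepConst f C₁) {w x : E d} (hw : 1 ≤ ‖w‖) (hxw : ‖x‖ ≤ ‖w‖ + 1) :
    f w ≤ ENNReal.ofReal C₁ * f x := by
  rcases le_total ‖x‖ ‖w‖ with h | h
  · calc f w ≤ f x := hf _ _ h
      _ ≤ ENNReal.ofReal C₁ * f x := le_mul_of_one_le_left' (by simpa using hC₁.1)
  · exact hC₁.2 w x hw h hxw

/-- For `‖x‖ ≤ 2`, the value at a point of at least half the norm of `x` exceeds the one at `x` by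
the factor `C₁ ∨ C₂` at most. Below norm `1` this is doubling, above it is the step condition. -/
theorem le_mul_of_half_norm_le {f : E d → ℝ≥0∞} (hf : RadiallyAntitone f) {C₁ C₂ : ℝ}
    (hC₁ : IsStepConst f C₁) (hC₂ : IsDoublingAtZeroConst f C₂) {w x : E d} (hx : ‖x‖ ≤ 2)
    (hw : ‖x‖ / 2 ≤ ‖w‖) : f w ≤ ENNReal.ofReal (max C₁ C₂) * f x := by
  rcases le_total ‖w‖ 1 with h | h
  · calc f w ≤ ENNReal.ofReal C₂ * f ((2 : ℝ) • w) := hC₂.2 w h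
      _ ≤ ENNReal.ofReal (max C₁ C₂) * f x := by
        gcongr
        · exact le_max_right _ _
        · apply hf
          rw [norm_smul, Real.norm_of_nonneg (by norm_num)]
          linarith
  · refine (hC₁.le_mul hf h (x := x) (by linarith)).trans ?_
    gcongr
    exact le_max_left _ _

theorem lintegral_eq_ofReal_l1norm {f : E d → ℝ≥0∞} (hf : ∫⁻ x, f x < ∞) :
    ∫⁻ x, f x = ENNReal.ofReal (l1norm f) :=
  (ENNReal.ofReal_toReal hf.ne).symm

theorem l1norm_nonneg (f : E d → ℝ≥0∞) : 0 ≤ l1norm f := ENNReal.toReal_nonneg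

theorem M₂_nonneg (f : E d → ℝ≥0∞) {C₁ : ℝ} (hC₁ : 1 ≤ C₁) (C₂ : ℝ) : 0 ≤ M₂ f C₁ C₂ :=
  mul_nonneg (by linarith [le_max_left C₁ C₂]) (l1norm_nonneg f)

/-- For `‖x‖ ≤ 2` every `y` is far from `0` or far from `x`, at least by `‖x‖ / 2`. Hence one of the
two factors in the convolution is at most `C₁ ∨ C₂` times its bound at `x`, and the other one is
integrated over the whole space. -/
theorem convPow_le_of_norm_le_two {f : E d → ℝ≥0∞} (hfm : Measurable f) (hf : RadiallyAntitone f)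
    (hfi : ∫⁻ x, f x < ∞) {C₁ C₂ : ℝ}
    (hC₁ : IsStepConst f C₁) (hC₂ : IsDoublingAtZeroConst f C₂) (n : ℕ) (x : E d) (hx : ‖x‖ ≤ 2) :
    convPow f (n + 1) x ≤ (n + 1) * ENNReal.ofReal (M₂ f C₁ C₂) ^ n * f x := by
  have hC : 1 ≤ max C₁ C₂ := hC₁.1.trans (le_max_left _ _)
  have hM : ENNReal.ofReal (M₂ f C₁ C₂) = ENNReal.ofReal (max C₁ C₂) * ∫⁻ x, f x := by
    rw [M₂, ENNReal.ofReal_mul (by linarith), lintegral_eq_ofReal_l1norm hfi]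
  set M := ENNReal.ofReal (M₂ f C₁ C₂)
  set c := ENNReal.ofReal (max C₁ C₂) with hc
  set I := ∫⁻ x, f x with hI
  have hc1 : 1 ≤ c := by simpa [hc] using hC
  have hIM : I ≤ M := hM ▸ le_mul_of_one_le_left' hc1
  induction n generalizing x with
  | zero => simp [convPow]
  | succ n ih =>
    have hh := measurable_convPow hfm (n + 1)
    have hfx : Measurable fun y => f (x - y) := hfm.comp (by fun_prop)
    have hpt : ∀ y, f (x - y) * convPow f (n + 1) y ≤
        c * f x * convPow f (n + 1) y + f (x - y) * ((n + 1) * M ^ n * (c * f x)) := by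
      intro y
      have htri : ‖x‖ ≤ ‖x - y‖ + ‖y‖ := by
        simpa using norm_add_le (x - y) y
      rcases le_total (‖x‖ / 2) ‖x - y‖ with h | h
      · refine le_add_right ?_
        gcongr
        exact le_mul_of_half_norm_le hf hC₁ hC₂ hx h
      · refine le_add_left ?_
        gcongr
        rcases le_total ‖y‖ 2 with h2 | h2
        · refine (ih y h2).trans ?_
          gcongr
          exact le_mul_of_half_norm_le hf hC₁ hC₂ hx (by linarith)
        · refine (radiallyAntitone_convPow hfm hf (n + 1) x y (hx.trans h2)).trans
            ((ih x hx).trans ?_)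
          gcongr
          exact le_mul_of_one_le_left' hc1
    change ∫⁻ y, f (x - y) * convPow f (n + 1) y ≤ _
    refine (lintegral_mono hpt).trans ?_
    rw [lintegral_add_left (by fun_prop), lintegral_const_mul _ hh, lintegral_mul_const _ hfx,
      lintegral_convPow hfm, lintegral_sub_left_eq_self, ← hI]
    calc c * f x * I ^ (n + 1) + I * ((n + 1) * M ^ n * (c * f x))
        = (c * I) * I ^ n * f x + (n + 1) * (c * I) * M ^ n * f x := by ring
      _ = M * I ^ n * f x + (n + 1) * M * M ^ n * f x := by rw [hM]
      _ ≤ M * M ^ n * f x + (n + 1) * M * M ^ n * f x := by gcongr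
      _ = _ := by push_cast; ring

/-- The polynomial in `r ^ q` that bounds `f^{n⋆}(x) / f(x)` at `|x| = r`, up to a constant. -/
noncomputable def upperPoly (M κ q : ℝ) (n : ℕ) (r : ℝ) : ℝ :=
  ∑ j ∈ Finset.range n, (n.choose (j + 1) : ℝ) * M ^ (n - 1 - j) * κ ^ (j + 1) /
    Real.Gamma (q * (j + 1)) * r ^ (q * j)

theorem upperPoly_term_nonneg {M κ q : ℝ} (hM : 0 ≤ M) (hκ : 0 ≤ κ) (hq : 0 < q) (n j : ℕ) :
    0 ≤ (n.choose (j + 1) : ℝ) * M ^ (n - 1 - j) * κ ^ (j + 1) / Real.Gamma (q * (j + 1)) := by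
  have := Real.Gamma_pos_of_pos (show 0 < q * ((j : ℝ) + 1) by positivity)
  positivity

theorem upperPoly_nonneg {M κ q r : ℝ} (hM : 0 ≤ M) (hκ : 0 ≤ κ) (hq : 0 < q) (hr : 0 ≤ r)
    (n : ℕ) : 0 ≤ upperPoly M κ q n r :=
  Finset.sum_nonneg fun j _ =>
    mul_nonneg (upperPoly_term_nonneg hM hκ hq n j) (Real.rpow_nonneg hr _)

theorem upperPoly_mono {M κ q r s : ℝ} (hM : 0 ≤ M) (hκ : 0 ≤ κ) (hq : 0 < q) (hr : 0 ≤ r)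
    (hrs : r ≤ s) (n : ℕ) : upperPoly M κ q n r ≤ upperPoly M κ q n s := by
  refine Finset.sum_le_sum fun j _ => mul_le_mul_of_nonneg_left ?_
    (upperPoly_term_nonneg hM hκ hq n j)
  exact Real.rpow_le_rpow hr hrs (by positivity)

/-- The polynomial for `n = 1` is the constant `D`, so that the upper bound holds with equality
for `n = 1`. -/
theorem upperPoly_one {D q r : ℝ} (hq : 0 < q) (M : ℝ) :
    upperPoly M (D * Real.Gamma q) q 1 r = D := by
  have := (Real.Gamma_pos_of_pos hq).ne'
  simp [upperPoly, this]

/-- The constant term of the polynomial. -/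
theorem le_upperPoly {M D q r : ℝ} (hM : 0 ≤ M) (hD : 0 ≤ D) (hq : 0 < q) (hr : 0 ≤ r) (n : ℕ) :
    D * ((n + 1) * M ^ n) ≤ upperPoly M (D * Real.Gamma q) q (n + 1) r := by
  have hΓ := Real.Gamma_pos_of_pos hq
  refine le_trans (le_of_eq ?_) (Finset.single_le_sum (f := fun j : ℕ =>
    (((n + 1).choose (j + 1) : ℕ) : ℝ) * M ^ (n + 1 - 1 - j) * (D * Real.Gamma q) ^ (j + 1) /
      Real.Gamma (q * (j + 1)) * r ^ (q * j)) (fun j _ =>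
    mul_nonneg (upperPoly_term_nonneg hM (by positivity) hq (n + 1) j) (Real.rpow_nonneg hr _))
    (Finset.mem_range.mpr (Nat.succ_pos n)))
  simp
  field_simp

/-- Pascal's rule turns the polynomial for `n + 1` into the three contributions to the convolution:
`y` close to `0`, `y` close to `x`, and the main region, where the beta integrals appear. -/
theorem upperPoly_succ {D q r : ℝ} (hq : 0 < q) (hr : 0 < r) (M : ℝ) (n : ℕ) :
    upperPoly M (D * Real.Gamma q) q (n + 1) r =
      D * M ^ n + M * upperPoly M (D * Real.Gamma q) q n r +
      ∑ j ∈ Finset.range n, (n.choose (j + 1) : ℝ) * M ^ (n - 1 - j) *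
        (D * Real.Gamma q) ^ (j + 1) / Real.Gamma (q * (j + 1)) *
        (D * (Real.Gamma q * Real.Gamma (q + q * j) / Real.Gamma (q + (q + q * j))) *
          r ^ (q + q * j)) := by
  have hΓ := Real.Gamma_pos_of_pos hq
  have hΓj : ∀ j : ℕ, 0 < Real.Gamma (q * ((j : ℝ) + 1)) := fun j =>
    Real.Gamma_pos_of_pos (by positivity)
  set κ := D * Real.Gamma q with hκ
  have h1 : upperPoly M κ q (n + 1) r =
      ∑ j ∈ Finset.range (n + 1), (n.choose j : ℝ) * M ^ (n - j) * κ ^ (j + 1) /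
        Real.Gamma (q * (j + 1)) * r ^ (q * j) +
      ∑ j ∈ Finset.range (n + 1), (n.choose (j + 1) : ℝ) * M ^ (n - j) * κ ^ (j + 1) /
        Real.Gamma (q * (j + 1)) * r ^ (q * j) := by
    rw [← Finset.sum_add_distrib]
    refine Finset.sum_congr rfl fun j _ => ?_
    rw [Nat.choose_succ_succ, Nat.add_sub_cancel]
    push_cast
    ring
  rw [h1, Finset.sum_range_succ' (fun j : ℕ => (n.choose j : ℝ) * M ^ (n - j) * κ ^ (j + 1) /
    Real.Gamma (q * (j + 1)) * r ^ (q * j)), Finset.sum_range_succ (fun j : ℕ =>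
    (n.choose (j + 1) : ℝ) * M ^ (n - j) * κ ^ (j + 1) /
    Real.Gamma (q * (j + 1)) * r ^ (q * j))]
  have h2 : ∑ j ∈ Finset.range n, (n.choose (j + 1) : ℝ) * M ^ (n - j) * κ ^ (j + 1) /
      Real.Gamma (q * (j + 1)) * r ^ (q * j) = M * upperPoly M κ q n r := by
    rw [upperPoly, Finset.mul_sum]
    refine Finset.sum_congr rfl fun j hj => ?_
    have : n - j = (n - 1 - j) + 1 := by have := Finset.mem_range.mp hj; omega
    rw [this, pow_succ]; ring
  have h3 : ∀ j ∈ Finset.range n, (n.choose (j + 1) : ℝ) * M ^ (n - (j + 1)) *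
      κ ^ (j + 1 + 1) / Real.Gamma (q * (((j + 1 : ℕ) : ℝ) + 1)) * r ^ (q * ((j + 1 : ℕ) : ℝ)) =
      (n.choose (j + 1) : ℝ) * M ^ (n - 1 - j) * κ ^ (j + 1) / Real.Gamma (q * (j + 1)) *
        (D * (Real.Gamma q * Real.Gamma (q + q * j) / Real.Gamma (q + (q + q * j))) *
          r ^ (q + q * j)) := by
    intro j _
    have e1 : q + q * (j : ℝ) = q * (j + 1) := by ring
    have e2 : q + q * ((j : ℝ) + 1) = q * (((j + 1 : ℕ) : ℝ) + 1) := by push_cast; ring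
    have e3 : n - (j + 1) = n - 1 - j := by omega
    have e4 : q * ((j + 1 : ℕ) : ℝ) = q * (j + 1) := by push_cast; ring
    have := hΓj j
    have := hΓj (j + 1)
    rw [e1, e2, e3, e4, pow_succ κ (j + 1)]
    nth_rw 2 [hκ]
    field_simp
  rw [Finset.sum_congr rfl h3, h2]
  simp only [Nat.choose_zero_right, Nat.choose_succ_self, Nat.cast_one, Nat.cast_zero, zero_mul,
    zero_div, mul_zero, zero_add, add_zero, Real.rpow_zero, mul_one, one_mul, Nat.sub_zero, pow_one]
  have h4 : M ^ n * κ / Real.Gamma q = D * M ^ n := by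
    rw [hκ]; field_simp
  rw [h4]
  abel

/-- Pointwise upper bound for the convolution powers. For `‖x‖ ≥ 2` the integral over `y` is split:
if `‖y‖ < 1` or `‖x - y‖ ≥ ‖x‖`, then `f (x - y) ≤ C₁ f x`; if `‖y‖ ≥ ‖x‖ - 1`, then the bound for
`f^{n⋆}` at `y` is at most `C₁` times the one at `x`, where for `‖y‖ ≥ ‖x‖` it matters that `f^{n⋆}`
itself is radially nonincreasing; the rest is the main region. -/
theorem convPow_le (hd : 1 ≤ d) {m γ C₁ C₂ : ℝ} (hm : 0 < m) (hγ₀ : 0 ≤ γ)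
    (hγ : γ < ((d : ℝ) + 1) / 2) {k : Kind} {f : E d → ℝ≥0∞}
    (hf : f = expDensity d m (profile γ k))
    (hC₁ : IsStepConst f C₁) (hC₂ : IsDoublingAtZeroConst f C₂)
    {n : ℕ} (hn : 1 ≤ n) (x : E d) (hx : 1 ≤ ‖x‖) :
    convPow f n x ≤ ENNReal.ofReal ((D₂ d m)⁻¹ * (Real.exp (-m * ‖x‖) * ‖x‖ ^ (-γ)) *
      upperPoly (M₂ f C₁ C₂) (κ₂ d m γ) (ρ₂ d γ) n ‖x‖) := by
  have hd1 : (1 : ℝ) ≤ d := by exact_mod_cast hd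
  have hfm : Measurable f := hf ▸ measurable_expDensity m γ k
  have hfa : RadiallyAntitone f := hf ▸ radiallyAntitone_expDensity hm hγ₀ k
  have hfi : ∫⁻ x, f x < ∞ := hf ▸ lintegral_expDensity_lt_top hd hm hγ₀ (by linarith) k
  have hf1 : ∀ x : E d, 1 ≤ ‖x‖ → f x = ENNReal.ofReal (Real.exp (-m * ‖x‖) * ‖x‖ ^ (-γ)) :=
    fun x hx => hf ▸ expDensity_of_one_le m γ k hx
  have hq := ρ₂_pos hγ
  have hD := one_pos.trans_le (one_le_D₂ d m)
  have hM := M₂_nonneg f hC₁.1 C₂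
  have hC : 1 ≤ max C₁ C₂ := hC₁.1.trans (le_max_left _ _)
  have hL := l1norm_nonneg f
  have hκ : κ₂ d m γ = D₂ d m * Real.Gamma (ρ₂ d γ) := rfl
  have hκ0 : 0 < κ₂ d m γ := by
    rw [hκ]; exact mul_pos hD (Real.Gamma_pos_of_pos hq)
  have hI := lintegral_eq_ofReal_l1norm hfi
  have hMdef : M₂ f C₁ C₂ = max C₁ C₂ * l1norm f := rfl
  have hsmall := convPow_le_of_norm_le_two hfm hfa hfi hC₁ hC₂
  set M := M₂ f C₁ C₂
  set q := ρ₂ d γ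
  set κ := κ₂ d m γ
  set D := D₂ d m
  set L := l1norm f
  -- The bound holds near the unit sphere because it dominates the one for `‖x‖ ≤ 2`.
  have hnear : ∀ n, ∀ x : E d, 1 ≤ ‖x‖ → ‖x‖ ≤ 2 → convPow f (n + 1) x ≤
      ENNReal.ofReal (D⁻¹ * (Real.exp (-m * ‖x‖) * ‖x‖ ^ (-γ)) *
        upperPoly M κ q (n + 1) ‖x‖) := by
    intro n x hx hx2
    have h0 : (0 : ℝ) ≤ (n + 1) * M ^ n := by positivity
    have h1 : ((n : ℝ≥0∞) + 1) * ENNReal.ofReal M ^ n = ENNReal.ofReal ((n + 1) * M ^ n) := by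
      rw [ENNReal.ofReal_mul (by positivity), ENNReal.ofReal_pow hM,
        ENNReal.ofReal_add (by positivity) (by positivity)]
      simp
    refine (hsmall n x hx2).trans ?_
    rw [h1, hf1 x hx, ← ENNReal.ofReal_mul h0]
    apply ENNReal.ofReal_le_ofReal
    have h2 := le_upperPoly (r := ‖x‖) hM hD.le hq (norm_nonneg x) n
    rw [← hκ] at h2
    have h3 : (n + 1) * M ^ n ≤ D⁻¹ * upperPoly M κ q (n + 1) ‖x‖ := by
      rw [le_inv_mul_iff₀ hD]; exact h2
    calc (n + 1) * M ^ n * (Real.exp (-m * ‖x‖) * ‖x‖ ^ (-γ))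
        ≤ D⁻¹ * upperPoly M κ q (n + 1) ‖x‖ * (Real.exp (-m * ‖x‖) * ‖x‖ ^ (-γ)) := by gcongr
      _ = _ := by ring
  induction n, hn using Nat.le_induction generalizing x with
  | base =>
    change f x ≤ _
    rw [hf1 x hx, hκ, upperPoly_one hq]
    apply ENNReal.ofReal_le_ofReal
    rw [mul_right_comm, inv_mul_cancel₀ hD.ne', one_mul]
  | succ n hn ih =>
    rcases le_total ‖x‖ 2 with hx2 | hx2
    · exact hnear n x hx hx2
    obtain ⟨n, rfl⟩ : ∃ j, n = j + 1 := ⟨n - 1, by omega⟩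
    let P : ℝ → ℝ := fun r => D⁻¹ * (Real.exp (-m * r) * r ^ (-γ)) * upperPoly M κ q (n + 1) r
    have hP0 : ∀ r, 0 < r → 0 ≤ P r := by
      intro r hr
      have := upperPoly_nonneg hM hκ0.le hq hr.le (n + 1)
      simp only [P]
      positivity
    have hstep : ∀ y : E d, 1 ≤ ‖y‖ → ‖x‖ - 1 ≤ ‖y‖ → ‖y‖ ≤ ‖x‖ →
        ENNReal.ofReal (P ‖y‖) ≤ ENNReal.ofReal C₁ * ENNReal.ofReal (P ‖x‖) := by
      intro y hy1 hyx hyx'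
      have h1 := hC₁.le_mul hfa hy1 (show ‖x‖ ≤ ‖y‖ + 1 by linarith)
      have hq1 := upperPoly_nonneg hM hκ0.le hq (norm_nonneg y) (n + 1)
      have hq2 := upperPoly_mono hM hκ0.le hq (norm_nonneg y) hyx' (n + 1)
      have e : ∀ w : E d, 1 ≤ ‖w‖ → ENNReal.ofReal (P ‖w‖) =
          ENNReal.ofReal (D⁻¹ * upperPoly M κ q (n + 1) ‖w‖) * f w := by
        intro w hw
        have := upperPoly_nonneg hM hκ0.le hq (norm_nonneg w) (n + 1)
        rw [hf1 w hw, ← ENNReal.ofReal_mul (by positivity)]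
        congr 1
        simp only [P]; ring
      rw [e y hy1, e x hx]
      calc _ ≤ ENNReal.ofReal (D⁻¹ * upperPoly M κ q (n + 1) ‖x‖) *
            (ENNReal.ofReal C₁ * f x) := by gcongr
        _ = _ := by ring
    have hh := measurable_convPow hfm (n + 1)
    have hfx : Measurable fun y => f (x - y) := hfm.comp (by fun_prop)
    have hPm : Measurable fun y : E d => ENNReal.ofReal (P ‖y‖) := by
      simp only [P, upperPoly]; fun_prop
    have hpt : ∀ y, f (x - y) * convPow f (n + 1) y ≤
        ENNReal.ofReal C₁ * f x * convPow f (n + 1) y +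
        (f (x - y) * (ENNReal.ofReal C₁ * ENNReal.ofReal (P ‖x‖)) +
        (mainRegion x).indicator (fun y => f (x - y) * ENNReal.ofReal (P ‖y‖)) y) := by
      intro y
      have hc1 : 1 ≤ ENNReal.ofReal C₁ := by simpa using hC₁.1
      rcases le_or_gt ‖x‖ ‖x - y‖ with h | h
      · refine le_add_right ?_
        gcongr
        exact (hfa _ _ h).trans (le_mul_of_one_le_left' hc1)
      rcases lt_or_ge ‖y‖ 1 with hy1 | hy1
      · refine le_add_right ?_
        gcongr
        have := norm_sub_norm_le x y
        exact hC₁.le_mul hfa (by linarith) (by linarith)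
      refine le_add_left ?_
      rcases le_total ‖x‖ ‖y‖ with hyx | hyx
      · refine le_add_right ?_
        gcongr
        exact (radiallyAntitone_convPow hfm hfa (n + 1) x y hyx).trans
          ((ih x hx).trans (le_mul_of_one_le_left' hc1))
      rcases le_total (‖x‖ - 1) ‖y‖ with hyx1 | hyx1
      · refine le_add_right ?_
        gcongr
        exact (ih y hy1).trans (hstep y hy1 hyx1 hyx)
      · refine le_add_left ?_
        rw [Set.indicator_of_mem (show y ∈ mainRegion x from ⟨hy1, hyx1, h⟩)]
        gcongr
        exact ih y hy1
    change ∫⁻ y, f (x - y) * convPow f (n + 1) y ≤ _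
    refine (lintegral_mono hpt).trans ?_
    rw [lintegral_add_left (by fun_prop), lintegral_const_mul _ hh, lintegral_convPow hfm,
      lintegral_add_left (by fun_prop), lintegral_mul_const _ hfx, lintegral_sub_left_eq_self,
      lintegral_indicator (measurableSet_mainRegion x)]
    obtain ⟨a, ha⟩ : ∃ a : ℕ → ℝ, ∀ j, a j = ((n + 1).choose (j + 1) : ℝ) *
      M ^ (n + 1 - 1 - j) * κ ^ (j + 1) / Real.Gamma (q * (j + 1)) := ⟨_, fun _ => rfl⟩
    have ha0 : ∀ j, 0 ≤ a j := fun j => ha j ▸ upperPoly_term_nonneg hM hκ0.le hq _ _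
    let B : ℕ → ℝ := fun j =>
      D * (Real.Gamma q * Real.Gamma (q + q * j) / Real.Gamma (q + (q + q * j)))
    have hB0 : ∀ j, 0 ≤ B j := by
      intro j
      have h1 : 0 < Real.Gamma q := Real.Gamma_pos_of_pos hq
      have h2 : 0 < Real.Gamma (q + q * j) := Real.Gamma_pos_of_pos (by positivity)
      have h3 : 0 < Real.Gamma (q + (q + q * j)) := Real.Gamma_pos_of_pos (by positivity)
      simp only [B]; positivity
    have hmain : ∫⁻ y in mainRegion x, f (x - y) * ENNReal.ofReal (P ‖y‖) ≤
        ENNReal.ofReal (∑ j ∈ Finset.range (n + 1), D⁻¹ * a j *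
          (B j * (Real.exp (-m * ‖x‖) * (‖x‖ ^ (-γ) * ‖x‖ ^ (q + q * j))))) := by
      have e1 : ∀ y, f (x - y) * ENNReal.ofReal (P ‖y‖) = ∑ j ∈ Finset.range (n + 1),
          ENNReal.ofReal (D⁻¹ * a j) * (f (x - y) * ENNReal.ofReal
            (Real.exp (-m * ‖y‖) * (‖y‖ ^ (-γ) * ‖y‖ ^ (q * j)))) := by
        intro y
        have e2 : P ‖y‖ = ∑ j ∈ Finset.range (n + 1), D⁻¹ * a j *
            (Real.exp (-m * ‖y‖) * (‖y‖ ^ (-γ) * ‖y‖ ^ (q * j))) := by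
          simp only [P, upperPoly]
          rw [Finset.mul_sum]
          refine Finset.sum_congr rfl fun j _ => ?_
          rw [ha]; ring
        rw [e2, ENNReal.ofReal_sum_of_nonneg (fun j _ => by have := ha0 j; positivity),
          Finset.mul_sum]
        refine Finset.sum_congr rfl fun j _ => ?_
        have := ha0 j
        rw [ENNReal.ofReal_mul (by positivity)]
        ring
      simp_rw [e1]
      rw [lintegral_finsetSum _ (fun j _ => by fun_prop),
        ENNReal.ofReal_sum_of_nonneg (fun j _ => by have := ha0 j; have := hB0 j; positivity)]
      refine Finset.sum_le_sum fun j _ => ?_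
      have := ha0 j
      rw [lintegral_const_mul _ (by fun_prop),
        ENNReal.ofReal_mul (p := D⁻¹ * a j) (by positivity)]
      gcongr
      rw [hf]
      exact lintegral_mainRegion_mul_le hd hm hγ₀ hγ k x hx2 (b := q * j) (by positivity)
    rw [hI, hf1 x hx]
    have hC0 : 0 ≤ C₁ := zero_le_one.trans hC₁.1
    have hPx := hP0 ‖x‖ (by linarith)
    obtain ⟨F, hF⟩ : ∃ F, F = Real.exp (-m * ‖x‖) * ‖x‖ ^ (-γ) := ⟨_, rfl⟩
    have hF0 : 0 ≤ F := hF ▸ by positivity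
    have hsum0 : 0 ≤ ∑ j ∈ Finset.range (n + 1), D⁻¹ * a j *
          (B j * (Real.exp (-m * ‖x‖) * (‖x‖ ^ (-γ) * ‖x‖ ^ (q + q * j)))) :=
      Finset.sum_nonneg fun j _ => by have := ha0 j; have := hB0 j; positivity
    rw [← hF]
    refine (add_le_add_right (add_le_add_right hmain _) _).trans ?_
    rw [← ENNReal.ofReal_mul hC0, ← ENNReal.ofReal_pow hL, ← ENNReal.ofReal_mul (by positivity),
      ← ENNReal.ofReal_mul hC0, ← ENNReal.ofReal_mul hL,
      ← ENNReal.ofReal_add (by positivity) hsum0,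
      ← ENNReal.ofReal_add (by positivity) (by positivity)]
    apply ENNReal.ofReal_le_ofReal
    have hA : C₁ * F * L ^ (n + 1) ≤ F * M ^ (n + 1) := by
      have h1 : C₁ ≤ max C₁ C₂ ^ (n + 1) :=
        (le_max_left _ _).trans (le_self_pow₀ hC (Nat.succ_ne_zero n))
      calc C₁ * F * L ^ (n + 1) ≤ max C₁ C₂ ^ (n + 1) * F * L ^ (n + 1) := by gcongr
        _ = _ := by rw [hMdef, mul_pow]; ring
    have hB : L * (C₁ * P ‖x‖) ≤ M * P ‖x‖ := by
      rw [hMdef]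
      calc L * (C₁ * P ‖x‖) = C₁ * L * P ‖x‖ := by ring
        _ ≤ _ := by gcongr; exact le_max_left _ _
    refine (add_le_add hA (add_le_add_left hB _)).trans (le_of_eq ?_)
    have hs := upperPoly_succ (D := D) (r := ‖x‖) hq (by linarith) M (n + 1)
    rw [← hκ] at hs
    rw [hs, mul_add, mul_add, add_assoc, Finset.mul_sum]
    congr 1
    · field_simp
    congr 1
    · simp only [P]; rw [← hF]; ring
    · refine Finset.sum_congr rfl fun j _ => ?_
      simp only [B]
      rw [ha, hF]; ring

/-! ### Existence of the comparison constants -/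

theorem profileReal_le_two_rpow_mul {γ : ℝ} (hγ : 0 ≤ γ) (k : Kind) {r s : ℝ} (hr : 0 < r)
    (hs : 0 < s) (hsr : s ≤ 2 * r) : profileReal γ k r ≤ 2 ^ γ * profileReal γ k s := by
  have h1 := (profileReal_le_mul hγ k hr one_le_two).trans (profileReal_anti hγ k hs hsr)
  have h2 : (0 : ℝ) < 2 ^ γ := by positivity
  rw [Real.rpow_neg zero_le_two] at h1
  rwa [inv_mul_le_iff₀ h2] at h1

theorem expDensity_le_mul {m γ : ℝ} (hm : 0 < m) (hγ : 0 ≤ γ) (k : Kind) {x y : E d}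
    (hx : 0 < ‖x‖) (hy : 0 < ‖y‖) (hyx : ‖y‖ ≤ 2 * ‖x‖) (hyx' : ‖y‖ ≤ ‖x‖ + 1) :
    expDensity d m (profile γ k) x ≤
      ENNReal.ofReal (Real.exp m * 2 ^ γ) * expDensity d m (profile γ k) y := by
  have hv := profileReal_pos γ k hy
  rw [expDensity_eq_ofReal m γ k hx, expDensity_eq_ofReal m γ k hy,
    ← ENNReal.ofReal_mul (by positivity)]
  apply ENNReal.ofReal_le_ofReal
  have h1 : Real.exp (-m * ‖x‖) ≤ Real.exp m * Real.exp (-m * ‖y‖) := by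
    rw [← Real.exp_add]
    apply Real.exp_le_exp.mpr
    nlinarith
  calc _ ≤ (Real.exp m * Real.exp (-m * ‖y‖)) * (2 ^ γ * profileReal γ k ‖y‖) :=
        mul_le_mul h1 (profileReal_le_two_rpow_mul hγ k hx hy hyx)
          (profileReal_pos γ k hx).le (by positivity)
    _ = _ := by ring

theorem one_le_exp_mul_two_rpow {m γ : ℝ} (hm : 0 < m) (hγ : 0 ≤ γ) :
    1 ≤ Real.exp m * (2 : ℝ) ^ γ :=
  one_le_mul_of_one_le_of_one_le (Real.one_le_exp hm.le) (Real.one_le_rpow one_le_two hγ)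

theorem isStepConst_expDensity {m γ : ℝ} (hm : 0 < m) (hγ : 0 ≤ γ) (k : Kind) :
    IsStepConst (expDensity d m (profile γ k)) (Real.exp m * 2 ^ γ) := by
  refine ⟨one_le_exp_mul_two_rpow hm hγ, fun x y hx hxy hyx => ?_⟩
  exact expDensity_le_mul hm hγ k (by linarith) (by linarith) (by linarith) hyx

theorem isDoublingAtZeroConst_expDensity {m γ : ℝ} (hm : 0 < m) (hγ : 0 ≤ γ) (k : Kind) :
    IsDoublingAtZeroConst (expDensity d m (profile γ k)) (Real.exp m * 2 ^ γ) := by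
  refine ⟨one_le_exp_mul_two_rpow hm hγ, fun x hx => ?_⟩
  rcases eq_or_ne x 0 with rfl | hx0
  · rw [smul_zero]
    exact le_mul_of_one_le_left' (by simpa using one_le_exp_mul_two_rpow hm hγ)
  · have h0 : 0 < ‖x‖ := norm_pos_iff.mpr hx0
    have h2 : ‖(2 : ℝ) • x‖ = 2 * ‖x‖ := by
      rw [norm_smul, Real.norm_of_nonneg zero_le_two]
    exact expDensity_le_mul hm hγ k h0 (by rw [h2]; positivity) h2.le (by rw [h2]; linarith)

theorem isDoublingConst_profile {γ : ℝ} (hγ : 0 ≤ γ) (k : Kind) :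
    IsDoublingConst (profile γ k) (2 ^ γ) := by
  refine ⟨Real.one_le_rpow one_le_two hγ, fun r hr => ?_⟩
  have hr2 : 0 < 2 * r := by positivity
  rw [profile_eq_ofReal γ k hr, profile_eq_ofReal γ k hr2, ← ENNReal.ofReal_mul (by positivity)]
  exact ENNReal.ofReal_le_ofReal (profileReal_le_two_rpow_mul hγ k hr hr2 le_rfl)

/-! ### Bounds for the ratio of `f^{n⋆}` and `f` -/

/-- The terms of the binomial expansion below the top one are estimated by
`C(n + 1, i + 1) ≤ (n + 1) C(n, i + 1)`. -/
theorem sum_choose_le {M κ : ℝ} (hM : 0 ≤ M) (hκ : 0 ≤ κ) (n : ℕ) :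
    ∑ i ∈ Finset.range n, ((n + 1).choose (i + 1) : ℝ) * M ^ (n - i) * κ ^ (i + 1) ≤
      M * (n + 1) * (M + κ) ^ n := by
  have h1 : ∀ i ∈ Finset.range n, ((n + 1).choose (i + 1) : ℝ) * M ^ (n - i) * κ ^ (i + 1) ≤
      M * (n + 1) * (κ ^ (i + 1) * M ^ (n - (i + 1)) * (n.choose (i + 1) : ℝ)) := by
    intro i hi
    have hin := Finset.mem_range.mp hi
    have hc : (n + 1).choose (i + 1) ≤ n.choose (i + 1) * (n + 1) := by
      rw [Nat.choose_mul_succ_eq]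
      exact Nat.le_mul_of_pos_right _ (by omega)
    have hc' : ((n + 1).choose (i + 1) : ℝ) ≤ n.choose (i + 1) * (n + 1) := by exact_mod_cast hc
    have e : n - i = n - (i + 1) + 1 := by omega
    rw [e, pow_succ]
    calc _ ≤ ((n.choose (i + 1) : ℝ) * (n + 1)) * (M ^ (n - (i + 1)) * M) * κ ^ (i + 1) := by
          gcongr
      _ = _ := by ring
  refine (Finset.sum_le_sum h1).trans ?_
  rw [← Finset.mul_sum]
  gcongr
  rw [add_comm M κ, add_pow, Finset.sum_range_succ']
  exact le_add_of_nonneg_right (by positivity)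

/-- The top term of the polynomial gives the leading constant; the other ones are smaller by a
factor `r ^ q` at least. -/
theorem upperPoly_le {M D q r : ℝ} (hM : 0 ≤ M) (hD : 0 ≤ D) (hq : 0 < q) (hr : 1 ≤ r) (n : ℕ) :
    upperPoly M (D * Real.Gamma q) q (n + 1) r ≤
      (D * (D ^ n * (Real.Gamma q ^ (n + 1) / Real.Gamma (q * (n + 1)))) +
        2 * M * (n + 1) * (M + D * Real.Gamma q) ^ n / r ^ q) * r ^ (q * n) := by
  have hr0 : 0 < r := by linarith
  have hΓ := Real.Gamma_pos_of_pos hq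
  set κ := D * Real.Gamma q with hκ
  have hκ0 : 0 ≤ κ := by positivity
  have h1 : ∀ i ∈ Finset.range n, ((n + 1).choose (i + 1) : ℝ) * M ^ (n + 1 - 1 - i) *
      κ ^ (i + 1) / Real.Gamma (q * (i + 1)) * r ^ (q * i) ≤
      2 * (r ^ (q * n) / r ^ q) *
        (((n + 1).choose (i + 1) : ℝ) * M ^ (n - i) * κ ^ (i + 1)) := by
    intro i hi
    have hin : (i : ℝ) + 1 ≤ n := by exact_mod_cast Finset.mem_range.mp hi
    have hG := half_le_Gamma (show 0 < q * ((i : ℝ) + 1) by positivity)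
    have hG' : (Real.Gamma (q * ((i : ℝ) + 1)))⁻¹ ≤ 2 := by
      rw [inv_le_comm₀ (by linarith) two_pos]; linarith
    have hp : r ^ (q * i) ≤ r ^ (q * n) / r ^ q := by
      rw [← Real.rpow_sub hr0]
      apply Real.rpow_le_rpow_of_exponent_le hr
      nlinarith
    have hG0 : 0 ≤ (Real.Gamma (q * ((i : ℝ) + 1)))⁻¹ := inv_nonneg.mpr (by linarith)
    rw [Nat.add_sub_cancel, div_eq_mul_inv]
    calc _ ≤ ((n + 1).choose (i + 1) : ℝ) * M ^ (n - i) * κ ^ (i + 1) * 2 *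
          (r ^ (q * n) / r ^ q) := by gcongr
      _ = _ := by ring
  rw [upperPoly, Finset.sum_range_succ]
  refine (add_le_add_left (Finset.sum_le_sum h1) _).trans ?_
  rw [← Finset.mul_sum]
  have h2 := sum_choose_le hM hκ0 n
  have h3 : 0 ≤ 2 * (r ^ (q * n) / r ^ q) := by positivity
  refine (add_le_add_left (mul_le_mul_of_nonneg_left h2 h3) _).trans (le_of_eq ?_)
  rw [Nat.choose_self, Nat.add_sub_cancel, Nat.sub_self, hκ]
  push_cast
  ring

theorem le_convRatio (hd : 1 ≤ d) {m γ C₃ : ℝ} (hm : 0 < m) (hγ₀ : 0 ≤ γ)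
    (hγ : γ < ((d : ℝ) + 1) / 2) {k : Kind} (hC₃ : IsDoublingConst (profile γ k) C₃)
    {n : ℕ} (hn : 1 ≤ n) (x : E d) (hx : 1 ≤ ‖x‖) :
    ENNReal.ofReal (D₁ d m γ C₃ k ^ (n - 1) *
        (Real.Gamma (ρ₁ d γ k) ^ n / Real.Gamma (ρ₁ d γ k * n))) ≤
      convRatio (expDensity d m (profile γ k)) γ n x := by
  obtain ⟨n, rfl⟩ : ∃ j, n = j + 1 := ⟨n - 1, by omega⟩
  have hx0 : 0 < ‖x‖ := by linarith
  have h := le_convPow hd hm hγ₀ hγ hC₃ n x hx0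
  rw [convRatio, expDensity_of_one_le m γ k hx, ← ENNReal.ofReal_mul (by positivity),
    ENNReal.le_div_iff_mul_le (Or.inl (by simpa using by positivity))
      (Or.inl ENNReal.ofReal_ne_top),
    ← ENNReal.ofReal_mul' (by positivity)]
  refine le_trans (le_of_eq ?_) h
  congr 1
  rw [profileReal_of_one_le γ k hx, lowerWeight_of_one_le d γ k hx, ← Real.rpow_natCast (_ ^ _) n,
    ← Real.rpow_mul hx0.le, lowerConst, Nat.add_sub_cancel, ρ₂]
  push_cast
  rw [add_sub_cancel_right]
  ring

theorem convRatio_le (hd : 1 ≤ d) {m γ C₁ C₂ : ℝ} (hm : 0 < m) (hγ₀ : 0 ≤ γ)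
    (hγ : γ < ((d : ℝ) + 1) / 2) {k : Kind} {f : E d → ℝ≥0∞}
    (hf : f = expDensity d m (profile γ k))
    (hC₁ : IsStepConst f C₁) (hC₂ : IsDoublingAtZeroConst f C₂)
    {n : ℕ} (hn : 1 ≤ n) (x : E d) (hx : 1 ≤ ‖x‖) :
    convRatio f γ n x ≤ ENNReal.ofReal (D₂ d m ^ (n - 1) *
        (Real.Gamma (ρ₂ d γ) ^ n / Real.Gamma (ρ₂ d γ * n)) +
      2 * M₂ f C₁ C₂ * n * (M₂ f C₁ C₂ + κ₂ d m γ) ^ (n - 1) /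
        (D₂ d m * ‖x‖ ^ (((d : ℝ) + 1) / 2 - γ))) := by
  have h := convPow_le hd hm hγ₀ hγ hf hC₁ hC₂ hn x hx
  obtain ⟨n, rfl⟩ : ∃ j, n = j + 1 := ⟨n - 1, by omega⟩
  have hx0 : 0 < ‖x‖ := by linarith
  have hD := one_pos.trans_le (one_le_D₂ d m)
  have hM := M₂_nonneg f hC₁.1 C₂
  have hq := ρ₂_pos hγ
  have hp := upperPoly_le (D := D₂ d m) hM hD.le hq hx n
  rw [convRatio, hf, expDensity_of_one_le m γ k hx, ← hf, ← ENNReal.ofReal_mul (by positivity)]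
  refine ENNReal.div_le_of_le_mul ?_
  rw [← ENNReal.ofReal_mul' (by positivity)]
  refine h.trans (ENNReal.ofReal_le_ofReal ?_)
  have hκ : κ₂ d m γ = D₂ d m * Real.Gamma (ρ₂ d γ) := rfl
  have hq' : ((d : ℝ) + 1) / 2 - γ = ρ₂ d γ := rfl
  rw [hq', hκ]
  have hn : ((n + 1 : ℕ) : ℝ) = n + 1 := by push_cast; ring
  rw [hn, add_sub_cancel_right, Nat.add_sub_cancel]
  refine (mul_le_mul_of_nonneg_left hp (by positivity)).trans (le_of_eq ?_)
  field_simp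

theorem limsup_convRatio_le (hd : 1 ≤ d) {m γ C₁ C₂ : ℝ} (hm : 0 < m) (hγ₀ : 0 ≤ γ)
    (hγ : γ < ((d : ℝ) + 1) / 2) {k : Kind} {f : E d → ℝ≥0∞}
    (hf : f = expDensity d m (profile γ k))
    (hC₁ : IsStepConst f C₁) (hC₂ : IsDoublingAtZeroConst f C₂) {n : ℕ} (hn : 1 ≤ n) :
    limsup (convRatio f γ n) (Bornology.cobounded (E d)) ≤
      ENNReal.ofReal (D₂ d m ^ (n - 1) *
        (Real.Gamma (ρ₂ d γ) ^ n / Real.Gamma (ρ₂ d γ * n))) := by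
  have : Nonempty (Fin d) := ⟨⟨0, hd⟩⟩
  have hnb : (Bornology.cobounded (E d)).NeBot := inferInstance
  have hq := ρ₂_pos hγ
  have hD := one_pos.trans_le (one_le_D₂ d m)
  have hev : ∀ᶠ x in Bornology.cobounded (E d), convRatio f γ n x ≤
      ENNReal.ofReal (D₂ d m ^ (n - 1) *
        (Real.Gamma (ρ₂ d γ) ^ n / Real.Gamma (ρ₂ d γ * n)) +
      2 * M₂ f C₁ C₂ * n * (M₂ f C₁ C₂ + κ₂ d m γ) ^ (n - 1) /
        (D₂ d m * ‖x‖ ^ (((d : ℝ) + 1) / 2 - γ))) := by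
    filter_upwards [tendsto_norm_cobounded_atTop.eventually_ge_atTop 1] with x hx
    exact convRatio_le hd hm hγ₀ hγ hf hC₁ hC₂ hn x hx
  refine (limsup_le_limsup hev).trans (le_of_eq ?_)
  apply Tendsto.limsup_eq
  refine (ENNReal.continuous_ofReal.tendsto _).comp ?_
  have h1 : Tendsto (fun x : E d => D₂ d m * ‖x‖ ^ (((d : ℝ) + 1) / 2 - γ))
      (Bornology.cobounded (E d)) atTop :=
    ((tendsto_rpow_atTop hq).comp tendsto_norm_cobounded_atTop).const_mul_atTop hD
  simpa using (h1.const_div_atTop _).const_add _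

/-! ### Bounds for the compound Poisson density -/

theorem wright_term_nonneg {ρ t : ℝ} (hρ : 0 < ρ) (ht : 0 ≤ t) (n : ℕ) :
    0 ≤ t ^ n / (Real.Gamma (ρ * n + 0) * (n.factorial : ℝ)) := by
  rw [add_zero]
  have : 0 ≤ Real.Gamma (ρ * n) := Real.Gamma_nonneg_of_nonneg (by positivity)
  positivity

theorem summable_wright {ρ t : ℝ} (hρ : 0 < ρ) (ht : 0 ≤ t) :
    Summable fun n : ℕ => t ^ n / (Real.Gamma (ρ * n + 0) * (n.factorial : ℝ)) := by
  refine Summable.of_nonneg_of_le (wright_term_nonneg hρ ht) (fun n => ?_)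
    ((Real.summable_pow_div_factorial t).mul_left 2)
  have hf : (0 : ℝ) < n.factorial := by positivity
  rcases Nat.eq_zero_or_pos n with rfl | hn
  · simp
  · have hG := half_le_Gamma (show 0 < ρ * (n : ℝ) by positivity)
    rw [add_zero, div_le_iff₀ (by positivity)]
    have h0 : 0 ≤ t ^ n := by positivity
    calc t ^ n ≤ t ^ n * (2 * Real.Gamma (ρ * n)) := le_mul_of_one_le_right h0 (by linarith)
      _ = _ := by field_simp

/-- The term of index `0` of the Wright function with `β = 0` vanishes. -/
theorem wright_eq_tsum_succ {ρ t : ℝ} (hρ : 0 < ρ) (ht : 0 ≤ t) :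
    wright ρ 0 t = ∑' n : ℕ, t ^ (n + 1) /
      (Real.Gamma (ρ * (n + 1)) * ((n + 1).factorial : ℝ)) := by
  rw [wright, (summable_wright hρ ht).tsum_eq_zero_add]
  simp [Real.Gamma_zero]

theorem summable_wright_succ {ρ t : ℝ} (hρ : 0 < ρ) (ht : 0 ≤ t) :
    Summable fun n : ℕ => t ^ (n + 1) /
      (Real.Gamma (ρ * (n + 1)) * ((n + 1).factorial : ℝ)) := by
  simpa using (summable_nat_add_iff 1).mpr (summable_wright hρ ht)

theorem wright_succ_nonneg {ρ t : ℝ} (hρ : 0 < ρ) (ht : 0 ≤ t) (n : ℕ) :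
    0 ≤ t ^ (n + 1) / (Real.Gamma (ρ * (n + 1)) * ((n + 1).factorial : ℝ)) := by
  simpa using wright_term_nonneg hρ ht (n + 1)

theorem poissonRatio_eq {f : E d → ℝ≥0∞} {m lam : ℝ} {x : E d} :
    poissonRatio f m lam x =
      (∑' n : ℕ, ENNReal.ofReal (lam ^ (n + 1) / ((n + 1).factorial : ℝ)) *
        convPow f (n + 1) x) /
      ENNReal.ofReal (Real.exp (-m * ‖x‖) * ‖x‖ ^ (-(((d : ℝ) + 1) / 2))) := by
  rw [poissonRatio, compoundPoissonDensity, mul_assoc (Real.exp _),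
    ENNReal.ofReal_mul (Real.exp_pos _).le]
  exact ENNReal.mul_div_mul_left _ _ (by simpa using Real.exp_pos _) ENNReal.ofReal_ne_top

theorem rpow_neg_eq_mul_rpow_ρ₂ (d : ℕ) (γ : ℝ) {r : ℝ} (hr : 0 < r) :
    r ^ (-γ) = r ^ (-(((d : ℝ) + 1) / 2)) * r ^ ρ₂ d γ := by
  rw [← Real.rpow_add hr, ρ₂]
  congr 1; ring

theorem le_poissonRatio (hd : 1 ≤ d) {m γ C₃ : ℝ} (hm : 0 < m) (hγ₀ : 0 ≤ γ)
    (hγ : γ < ((d : ℝ) + 1) / 2) {k : Kind} (hC₃ : IsDoublingConst (profile γ k) C₃)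
    (x : E d) (hx : 1 ≤ ‖x‖) {lam : ℝ} (hlam : 0 < lam) :
    ENNReal.ofReal
        (wright (ρ₁ d γ k) 0 (κ₁ d m γ C₃ k * lam * ‖x‖ ^ (((d : ℝ) + 1) / 2 - γ))) ≤
      poissonRatio (expDensity d m (profile γ k)) m lam x := by
  have hd1 : (1 : ℝ) ≤ d := by exact_mod_cast hd
  have hx0 : 0 < ‖x‖ := by linarith
  have hρ : 0 < ρ₁ d γ k := (ρ₂_pos hγ).trans_le (ρ₂_le_ρ₁ hd hγ₀ k)
  have hΓ := Real.Gamma_pos_of_pos hρ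
  have hD := D₁_pos hd (m := m) (γ := γ) hC₃.1 k
  have hD1 := D₁_le_one hd (C₃ := C₃) hm (show γ < d by linarith) k
  have hκ : κ₁ d m γ C₃ k = D₁ d m γ C₃ k * Real.Gamma (ρ₁ d γ k) := rfl
  have hκ0 : 0 < κ₁ d m γ C₃ k := hκ ▸ mul_pos hD hΓ
  have hq' : ((d : ℝ) + 1) / 2 - γ = ρ₂ d γ := rfl
  have ht : 0 ≤ κ₁ d m γ C₃ k * lam * ‖x‖ ^ (((d : ℝ) + 1) / 2 - γ) := by positivity
  rw [poissonRatio_eq, wright_eq_tsum_succ hρ ht,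
    ENNReal.ofReal_tsum_of_nonneg (wright_succ_nonneg hρ ht) (summable_wright_succ hρ ht),
    ENNReal.le_div_iff_mul_le (Or.inl (by simpa using by positivity))
      (Or.inl ENNReal.ofReal_ne_top), ← ENNReal.tsum_mul_right]
  refine ENNReal.tsum_le_tsum fun n => ?_
  refine le_trans ?_ (mul_le_mul' le_rfl (le_convPow hd hm hγ₀ hγ hC₃ n x hx0))
  have hG : 0 < Real.Gamma (ρ₁ d γ k * (n + 1)) := Real.Gamma_pos_of_pos (by positivity)
  rw [← ENNReal.ofReal_mul' (by positivity), ← ENNReal.ofReal_mul (by positivity)]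
  apply ENNReal.ofReal_le_ofReal
  rw [profileReal_of_one_le γ k hx, lowerWeight_of_one_le d γ k hx, lowerConst, hq', hκ,
    rpow_neg_eq_mul_rpow_ρ₂ d γ hx0]
  have hpow : D₁ d m γ C₃ k ^ (n + 1) ≤ D₁ d m γ C₃ k ^ n :=
    pow_le_pow_of_le_one hD.le hD1 (Nat.le_succ n)
  calc _ = D₁ d m γ C₃ k ^ (n + 1) * (lam ^ (n + 1) / ((n + 1).factorial : ℝ) *
        (Real.Gamma (ρ₁ d γ k) ^ (n + 1) / Real.Gamma (ρ₁ d γ k * (n + 1)) *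
        Real.exp (-m * ‖x‖) * (‖x‖ ^ (-(((d : ℝ) + 1) / 2)) * ‖x‖ ^ ρ₂ d γ) *
          (‖x‖ ^ ρ₂ d γ) ^ n)) := by
        field_simp
        ring
    _ ≤ D₁ d m γ C₃ k ^ n * (lam ^ (n + 1) / ((n + 1).factorial : ℝ) *
        (Real.Gamma (ρ₁ d γ k) ^ (n + 1) / Real.Gamma (ρ₁ d γ k * (n + 1)) *
        Real.exp (-m * ‖x‖) * (‖x‖ ^ (-(((d : ℝ) + 1) / 2)) * ‖x‖ ^ ρ₂ d γ) *
          (‖x‖ ^ ρ₂ d γ) ^ n)) := by gcongr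
    _ = _ := by ring

/-- Multiplied by `lam ^ n / n!`, the polynomials `upperPoly` form the Cauchy product of an
exponential series and a Wright series. -/
theorem pow_div_factorial_mul_upperPoly (M κ lam : ℝ) {q r : ℝ} (hr : 0 < r) (n : ℕ) :
    lam ^ (n + 1) / ((n + 1).factorial : ℝ) * (r ^ q * upperPoly M κ q (n + 1) r) =
      ∑ j ∈ Finset.range (n + 1), (κ * lam * r ^ q) ^ (j + 1) /
        (Real.Gamma (q * (j + 1)) * ((j + 1).factorial : ℝ)) *
          ((M * lam) ^ (n - j) / ((n - j).factorial : ℝ)) := by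
  rw [upperPoly, Finset.mul_sum, Finset.mul_sum]
  refine Finset.sum_congr rfl fun j hj => ?_
  have hjn : j ≤ n := Nat.lt_succ_iff.mp (Finset.mem_range.mp hj)
  have hc : ((n + 1).choose (j + 1) : ℝ) =
      ((n + 1).factorial : ℝ) / (((j + 1).factorial : ℝ) * ((n - j).factorial : ℝ)) := by
    rw [Nat.cast_choose ℝ (Nat.succ_le_succ hjn)]
    simp [Nat.succ_sub_succ]
  have hl : lam ^ (n + 1) = lam ^ (j + 1) * lam ^ (n - j) := by
    rw [← pow_add]; congr 1; omega
  have hrp : r ^ (q * (j : ℝ)) = (r ^ q) ^ j := by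
    rw [Real.rpow_mul hr.le, Real.rpow_natCast]
  have h1 : ((n + 1).factorial : ℝ) ≠ 0 := by positivity
  rw [hc, hl, hrp, Nat.add_sub_cancel, mul_pow, mul_pow, mul_pow, div_eq_mul_inv,
    div_eq_mul_inv, div_eq_mul_inv, div_eq_mul_inv, div_eq_mul_inv, mul_inv, mul_inv]
  field_simp
  ring

theorem poissonRatio_le (hd : 1 ≤ d) {m γ C₁ C₂ : ℝ} (hm : 0 < m) (hγ₀ : 0 ≤ γ)
    (hγ : γ < ((d : ℝ) + 1) / 2) {k : Kind} {f : E d → ℝ≥0∞}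
    (hf : f = expDensity d m (profile γ k))
    (hC₁ : IsStepConst f C₁) (hC₂ : IsDoublingAtZeroConst f C₂)
    (x : E d) (hx : 1 ≤ ‖x‖) {lam : ℝ} (hlam : 0 < lam) :
    poissonRatio f m lam x ≤
      ENNReal.ofReal (Real.exp (M₂ f C₁ C₂ * lam) *
        wright (ρ₂ d γ) 0 (κ₂ d m γ * lam * ‖x‖ ^ (((d : ℝ) + 1) / 2 - γ))) := by
  have hx0 : 0 < ‖x‖ := by linarith
  have hq := ρ₂_pos hγ
  have hD := one_le_D₂ d m
  have hM := M₂_nonneg f hC₁.1 C₂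
  have hκ0 : 0 < κ₂ d m γ := mul_pos (by linarith) (Real.Gamma_pos_of_pos hq)
  have hq' : ((d : ℝ) + 1) / 2 - γ = ρ₂ d γ := rfl
  rw [hq']
  have ht : 0 ≤ κ₂ d m γ * lam * ‖x‖ ^ ρ₂ d γ := by positivity
  have hsb := summable_wright_succ hq ht
  have hb0 := wright_succ_nonneg hq ht
  rw [poissonRatio_eq, wright_eq_tsum_succ hq ht]
  refine ENNReal.div_le_of_le_mul ?_
  set M := M₂ f C₁ C₂
  set q := ρ₂ d γ
  set κ := κ₂ d m γ
  let b : ℕ → ℝ := fun n => (κ * lam * ‖x‖ ^ q) ^ (n + 1) /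
    (Real.Gamma (q * (n + 1)) * ((n + 1).factorial : ℝ))
  let a : ℕ → ℝ := fun n => (M * lam) ^ n / (n.factorial : ℝ)
  have hsa : Summable a := Real.summable_pow_div_factorial _
  have ha0 : ∀ n, 0 ≤ a n := fun n => by simp only [a]; positivity
  have hexp : Real.exp (M * lam) = ∑' n, a n := by
    rw [Real.exp_eq_exp_ℝ, NormedSpace.exp_eq_tsum_div]
  have hprod : Real.exp (M * lam) * ∑' n, b n =
      ∑' n, ∑ j ∈ Finset.range (n + 1), b j * a (n - j) := by
    rw [hexp, mul_comm]
    exact tsum_mul_tsum_eq_tsum_sum_range_of_summable_norm hsb.norm hsa.norm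
  have hsum : Summable fun n => ∑ j ∈ Finset.range (n + 1), b j * a (n - j) :=
    (summable_norm_sum_mul_range_of_summable_norm hsb.norm hsa.norm).of_norm
  have hc0 : ∀ n, 0 ≤ ∑ j ∈ Finset.range (n + 1), b j * a (n - j) := fun n =>
    Finset.sum_nonneg fun j _ => mul_nonneg (hb0 j) (ha0 _)
  change _ ≤ ENNReal.ofReal (Real.exp (M * lam) * ∑' n, b n) * _
  rw [hprod, ENNReal.ofReal_tsum_of_nonneg hc0 hsum, ← ENNReal.tsum_mul_right]
  refine ENNReal.tsum_le_tsum fun n => ?_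
  refine (mul_le_mul' le_rfl
    (convPow_le hd hm hγ₀ hγ hf hC₁ hC₂ (Nat.succ_pos n) x hx)).trans ?_
  rw [← ENNReal.ofReal_mul (by positivity), ← ENNReal.ofReal_mul (hc0 n)]
  apply ENNReal.ofReal_le_ofReal
  have hcp := pow_div_factorial_mul_upperPoly M κ lam (q := q) hx0 n
  change _ = ∑ j ∈ Finset.range (n + 1), b j * a (n - j) at hcp
  have hpoly := upperPoly_nonneg hM hκ0.le hq hx0.le (n + 1)
  rw [← hcp, rpow_neg_eq_mul_rpow_ρ₂ d γ hx0]
  calc _ = (D₂ d m)⁻¹ * (lam ^ (n + 1) / ((n + 1).factorial : ℝ) *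
        (‖x‖ ^ q * upperPoly M κ q (n + 1) ‖x‖) *
        (Real.exp (-m * ‖x‖) * ‖x‖ ^ (-(((d : ℝ) + 1) / 2)))) := by
        ring
    _ ≤ _ := mul_le_of_le_one_left (by positivity) (inv_le_one_of_one_le₀ hD)

end ExpDens

theorem theorem4p10 (d : ℕ) (hd : 1 ≤ d) (m : ℝ) (hm : 0 < m) (γ : ℝ) (hγ₀ : 0 ≤ γ)
    (hγ : γ < ((d : ℝ) + 1) / 2) (k : Kind)
    (g : ℝ → ℝ≥0∞) (hg : g = profile γ k) (f : E d → ℝ≥0∞) (hf : f = expDensity d m g) :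
    -- `f` is integrable and admissible constants exist
    (∫⁻ x, f x) < ∞ ∧
    (∃ C₁ C₂ C₃ : ℝ, IsStepConst f C₁ ∧ IsDoublingAtZeroConst f C₂ ∧ IsDoublingConst g C₃) ∧
    ∀ C₁ C₂ C₃ : ℝ, IsStepConst f C₁ → IsDoublingAtZeroConst f C₂ → IsDoublingConst g C₃ →
      -- estimates of the convolutions
      (∀ n : ℕ, 1 ≤ n →
        (∀ x : E d, 1 ≤ ‖x‖ →
          ENNReal.ofReal (D₁ d m γ C₃ k ^ (n - 1) *
              (Real.Gamma (ρ₁ d γ k) ^ n / Real.Gamma (ρ₁ d γ k * n))) ≤ convRatio f γ n x ∧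
          convRatio f γ n x ≤
            ENNReal.ofReal (D₂ d m ^ (n - 1) *
                (Real.Gamma (ρ₂ d γ) ^ n / Real.Gamma (ρ₂ d γ * n)) +
              2 * M₂ f C₁ C₂ * n * (M₂ f C₁ C₂ + κ₂ d m γ) ^ (n - 1) /
                (D₂ d m * ‖x‖ ^ (((d : ℝ) + 1) / 2 - γ)))) ∧
        ENNReal.ofReal (D₁ d m γ C₃ k ^ (n - 1) *
            (Real.Gamma (ρ₁ d γ k) ^ n / Real.Gamma (ρ₁ d γ k * n))) ≤
          liminf (convRatio f γ n) (Bornology.cobounded (E d)) ∧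
        liminf (convRatio f γ n) (Bornology.cobounded (E d)) ≤
          limsup (convRatio f γ n) (Bornology.cobounded (E d)) ∧
        limsup (convRatio f γ n) (Bornology.cobounded (E d)) ≤
          ENNReal.ofReal (D₂ d m ^ (n - 1) *
            (Real.Gamma (ρ₂ d γ) ^ n / Real.Gamma (ρ₂ d γ * n)))) ∧
      -- estimates of the compound Poisson density
      (∀ x : E d, 1 ≤ ‖x‖ → ∀ lam : ℝ, 0 < lam →
        ENNReal.ofReal
            (wright (ρ₁ d γ k) 0 (κ₁ d m γ C₃ k * lam * ‖x‖ ^ (((d : ℝ) + 1) / 2 - γ))) ≤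
          poissonRatio f m lam x ∧
        poissonRatio f m lam x ≤
          ENNReal.ofReal (Real.exp (M₂ f C₁ C₂ * lam) *
            wright (ρ₂ d γ) 0 (κ₂ d m γ * lam * ‖x‖ ^ (((d : ℝ) + 1) / 2 - γ)))) := by
  subst hg
  have hd1 : (1 : ℝ) ≤ d := by exact_mod_cast hd
  have : Nonempty (Fin d) := ⟨⟨0, hd⟩⟩
  have hnb : (Bornology.cobounded (E d)).NeBot := inferInstance
  refine ⟨hf ▸ lintegral_expDensity_lt_top hd hm hγ₀ (by linarith) k,
    ⟨Real.exp m * 2 ^ γ, Real.exp m * 2 ^ γ, 2 ^ γ, hf ▸ isStepConst_expDensity hm hγ₀ k,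
      hf ▸ isDoublingAtZeroConst_expDensity hm hγ₀ k, isDoublingConst_profile hγ₀ k⟩,
    fun C₁ C₂ C₃ hC₁ hC₂ hC₃ => ⟨fun n hn => ?_, fun x hx lam hlam => ?_⟩⟩
  · have hlow : ∀ x : E d, 1 ≤ ‖x‖ → _ ≤ convRatio f γ n x := fun x hx =>
      hf ▸ le_convRatio hd hm hγ₀ hγ hC₃ hn x hx
    refine ⟨fun x hx => ⟨hlow x hx, convRatio_le hd hm hγ₀ hγ hf hC₁ hC₂ hn x hx⟩, ?_,
      liminf_le_limsup, limsup_convRatio_le hd hm hγ₀ hγ hf hC₁ hC₂ hn⟩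
    refine le_liminf_of_le (h := ?_)
    filter_upwards [tendsto_norm_cobounded_atTop.eventually_ge_atTop 1] with x hx
    exact hlow x hx
  · exact ⟨hf ▸ le_poissonRatio hd hm hγ₀ hγ hC₃ x hx hlam,
      poissonRatio_le hd hm hγ₀ hγ hf hC₁ hC₂ x hx hlam⟩
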